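/- Let $f:\mathbb{C}\to\mathbb{C}$ be a transcendental entire function in the Eremenko–Lyubich class $\mathcal{B}$; that is, the set $S(f)$ of singular values, the closure in $\mathbb{C}$ of the set of all critical values and finite asymptotic values of $f$, is bounded. Suppose that $f$ has finite order, i.e. $\limsup_{r\to\infty}\frac{\log\log M(r,f)}{\log r}<\infty$, where $M(r,f)=\max_{|z|=r}|f(z)|$. Let $r_0>0$ be such that $S(f)\subset\{z:|z|\le r_0\}$, and put $$W=\{z\in\mathbb{C}: |f(e^z)|>r_0\},\qquad \theta(r)=\operatorname{meas}\{t\in[0,2\pi]: |f(re^{it})|<r_0\},$$ where $\operatorname{meas}$ is one-dimensional Lebesgue measure. Suppose that there exists $R_1>\max\{2\log r_0,\ \log r_0+64\pi\}$ such that $$W\subset\{z:\operatorname{Re} z>R_1\}.$$ Suppose further that $\theta(r)\ge\theta_0(r)$ for all large $r>0$, where $\theta_0:(0,\infty)\to\mathbb{R}$ is decreasing (not necessarily strictly) and satisfies $$\sum_{k=1}^{\infty}\theta_0\bigl(E^k(0)\bigr)=\infty,$$ $E^k$ being the $k$-th iterate of $E(x)=e^x$. Then the Julia set $\mathcal{J}(f)$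 (the set of points that have no neighbourhood on which the iterates $f^n$ form a normal family) has two-dimensional Lebesgue measure zero. -/

import Mathlib

open Set Filter Topology MeasureTheory

noncomputable section

namespace EntireDynamics

/-- A transcendental entire function: holomorphic on `ℂ` and not a polynomial. -/
def IsTranscendentalEntire (f : ℂ → ℂ) : Prop :=
  Differentiable ℂ f ∧ ¬ ∃ p : Polynomial ℂ, ∀ z, f z = p.eval z

/-- The critical values of `f`: the values `f a` at points `a` with `f' a = 0`. -/
def criticalValues (f : ℂ → ℂ) : Set ℂ :=
  {b | ∃ a, deriv f a = 0 ∧ f a = b}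

/-- The finite asymptotic values of `f`: the limits of `f` along curves tending to `∞`. -/
def asymptoticValues (f : ℂ → ℂ) : Set ℂ :=
  {b | ∃ γ : ℝ → ℂ, ContinuousOn γ (Ici 0) ∧ Tendsto γ atTop (Bornology.cobounded ℂ) ∧
    Tendsto (fun t => f (γ t)) atTop (𝓝 b)}

/-- The set `S(f)` of singular values of `f`. -/
def singularValues (f : ℂ → ℂ) : Set ℂ :=
  closure (criticalValues f ∪ asymptoticValues f)

/-- The Eremenko-Lyubich class `𝓑`. -/
def ClassB (f : ℂ → ℂ) : Prop :=
  IsTranscendentalEntire f ∧ Bornology.IsBounded (singularValues f)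

/-- The maximum modulus `M(r, f) = max_{|z| = r} |f z|` (for `r ≥ 0` and continuous `f` the
supremum is a maximum over a nonempty compact set). -/
def maxModulus (f : ℂ → ℂ) (r : ℝ) : ℝ :=
  sSup ((fun z => ‖f z‖) '' Metric.sphere (0 : ℂ) r)

/-- The order of growth `limsup_{r → ∞} log log M(r, f) / log r`, possibly infinite. -/
def order (f : ℂ → ℂ) : EReal :=
  limsup (fun r : ℝ =>
    ((Real.log (Real.log (maxModulus f r)) / Real.log r : ℝ) : EReal)) atTop

/-- Normality, in the sense of Montel, of a family of holomorphic functions on a domain `U`: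
every sequence from the family has a subsequence which, locally uniformly on `U`, either converges
to a finite function or tends to `∞`. -/
def IsNormalOn (𝓕 : Set (ℂ → ℂ)) (U : Set ℂ) : Prop :=
  ∀ g : ℕ → ℂ → ℂ, (∀ n, g n ∈ 𝓕) → ∃ φ : ℕ → ℕ, StrictMono φ ∧
    ((∃ h : ℂ → ℂ, TendstoLocallyUniformlyOn (fun n => g (φ n)) h atTop U) ∨
      ∀ K ⊆ U, IsCompact K → ∀ C : ℝ, ∀ᶠ n in atTop, ∀ z ∈ K, C ≤ ‖g (φ n) z‖)

/-- The Julia set `J(f)`: the points that have no neighbourhood (equivalently, no disc around them)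
on which the iterates of `f` form a normal family. -/
def juliaSet (f : ℂ → ℂ) : Set ℂ :=
  {z | ¬ ∃ ε > 0, IsNormalOn (range fun n : ℕ => f^[n]) (Metric.ball z ε)}

/-- The set `W = exp⁻¹(U)`, where `U = f⁻¹({z : |z| > r₀})`. -/
def logTracts (f : ℂ → ℂ) (r₀ : ℝ) : Set ℂ :=
  Complex.exp ⁻¹' (f ⁻¹' {z | r₀ < ‖z‖})

/-- `θ(r)`: the length of the set of `t ∈ [0, 2π]` with `|f(r e^{it})| < r₀`. -/
def theta (f : ℂ → ℂ) (r₀ r : ℝ) : ℝ :=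
  volume.real {t : ℝ | t ∈ Icc 0 (2 * Real.pi) ∧ ‖f (r * Complex.exp (t * Complex.I))‖ < r₀}

end EntireDynamics

end

/-!
Every point of the Julia set stays outside the disc `‖z‖ < e^{R₁}` for ever: the hypothesis on `W`
says that `f` maps the closed disc of radius `e^{R₁}` into the closed disc of radius
`r₀ < e^{R₁}`, so near an orbit that enters the larger disc the iterates are uniformly bounded and
equicontinuous, hence normal (`norm_iterate_ge_of_mem_juliaSet`). It remains to show that the set
`A` of points whose orbits never enter that disc is null, and it suffices to treat bounded parts
of `A`.

Let `B n` be the set of points that are captured by the disc `‖z‖ ≤ r₀` exactly at time `n + 2`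
(`captureSet`). These sets are pairwise disjoint, so the areas of their parts in a fixed disc have
a finite sum. On the other hand, for each `z ∈ A` and each `n` there is a radius `r ≤ C ‖z‖` such
that `B n` fills at least the proportion `c θ₀(|f^{n+1}(z)|)` of the disc of radius `r` about `z`
(`exists_ball_captureSet`). A Vitali covering of `A ∩ {‖z‖ ≤ R}` by such discs gives
`area(B n ∩ D) ≥ c' δ_n area(A ∩ {‖z‖ ≤ R})`, where `δ_n = θ₀(E^{n+1+m}(0))` is a lower bound
for `θ₀(|f^{n+1}(z)|)`: it exists because finite order bounds `|f^n(z)|` by an iterated exponential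
(`exists_norm_iterate_le`). As `∑ δ_n` diverges, `A ∩ {‖z‖ ≤ R}` is null. Only the total captured
area matters, so the pieces of consecutive generations need not be nested.

The discs come from inverse branches. As `f` has no critical or asymptotic value outside the disc of
radius `r₀`, paths there can be lifted, and `exp` lifts through `f` to a holomorphic map on the half
plane `H = {Re w > log r₀}` (`exists_holomorphic_lift`). This lift is injective: otherwise it is
periodic and descends to a punctured neighbourhood of `∞`, which would force `|f| > r₀` near `∞`,
contrary to `θ ≥ θ₀ > 0` (`not_periodic_lift`). Composing with logarithms gives univalent
branches `ψ` on `H` with `f^{n+1} ∘ ψ = exp` (`exists_inverse_branch_iterate`). Their distortion is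
controlled by a weak form of Koebe's theorem: if `g` is univalent on a disc of radius `R` about `c`
and omits `b`, then `log (g - b)` has an image without discs of radius `π`, so Bloch's theorem bounds
`R |g'(c)|` by a multiple of `|g(c) - b|` (`norm_deriv_le_of_injOn_of_notMem_image`). Thus
`R |g'|` is comparable with the distance of `g` to the boundary of its image, and integrating this
along segments bounds the variation of `|g'|` (`norm_deriv_le_distortionConst_mul`). In the
logarithmic plane, the discs about `w` with `Re w ≥ R₁` meet the complement of `W` in the proportion
required (`exists_ball_diff_logTracts`).
-/

namespace EntireDynamics

open Metric

variable {f : ℂ → ℂ} {r₀ : ℝ}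

/-! ### Univalent functions: Bloch, Koebe and bounded distortion -/

/-- A continuous local solution `g` of `F ∘ g = h`, with `F` analytic and `F' ≠ 0`, is holomorphic
wherever `h` is: locally `g` is the inverse of `F` applied to `h`. -/
theorem differentiableAt_of_comp_eventuallyEq {F g h : ℂ → ℂ} {w : ℂ} (hg : ContinuousAt g w)
    (hF : AnalyticAt ℂ F (g w)) (hF' : deriv F (g w) ≠ 0) (hh : DifferentiableAt ℂ h w)
    (heq : ∀ᶠ x in 𝓝 w, F (g x) = h x) : DifferentiableAt ℂ g w := by
  have hs : HasStrictDerivAt F (deriv F (g w)) (g w) := hF.hasStrictDerivAt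
  have hinv := hs.to_localInverse hF'
  have hleft := hs.eventually_left_inverse hF'
  have hev : g =ᶠ[𝓝 w] (fun x => hs.localInverse F _ _ hF' (h x)) := by
    filter_upwards [hg.eventually hleft, heq] with x hx hx'
    rw [← hx', hx]
  have hw : h w = F (g w) := heq.self_of_nhds.symm
  rw [hev.differentiableAt_iff]
  rw [← hw] at hinv
  exact hinv.hasDerivAt.differentiableAt.comp w hh

/-- If `|h'|` is at most twice its value at the centre, then `h` is close to its linear part on a
smaller disc, and its image contains a disc of definite size. -/
theorem closedBall_subset_image_of_norm_deriv_le {h : ℂ → ℂ} {a : ℂ} {ρ : ℝ} (hρ : 0 < ρ)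
    (hh : DifferentiableOn ℂ h (ball a ρ))
    (hb : ∀ z ∈ ball a ρ, ‖deriv h z‖ ≤ 2 * ‖deriv h a‖) :
    closedBall (h a) (ρ * ‖deriv h a‖ / 12) ⊆ h '' ball a ρ := by
  rcases eq_or_ne (deriv h a) 0 with h0 | h0
  · simp only [h0, norm_zero, mul_zero, zero_div, closedBall_zero, singleton_subset_iff]
    exact mem_image_of_mem _ (mem_ball_self hρ)
  have hn : 0 < ‖deriv h a‖ := norm_pos_iff.2 h0
  have hd : DifferentiableOn ℂ (deriv h) (ball a ρ) := hh.deriv isOpen_ball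
  have hmaps : MapsTo (deriv h) (ball a ρ) (closedBall (deriv h a) (3 * ‖deriv h a‖)) := by
    intro z hz
    rw [mem_closedBall, dist_eq_norm]
    calc ‖deriv h z - deriv h a‖ ≤ ‖deriv h z‖ + ‖deriv h a‖ := norm_sub_le _ _
      _ ≤ 3 * ‖deriv h a‖ := by linarith [hb z hz]
  have hsub : closedBall a (ρ / 6) ⊆ ball a ρ := closedBall_subset_ball (by linarith)
  have key : ∀ z ∈ closedBall a (ρ / 6), ‖deriv h z - deriv h a‖ ≤ ‖deriv h a‖ / 2 := by
    intro z hz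
    have := Complex.dist_le_div_mul_dist_of_mapsTo_ball hd hmaps (hsub hz)
    rw [dist_eq_norm] at this
    have hz' : dist z a ≤ ρ / 6 := hz
    calc _ ≤ 3 * ‖deriv h a‖ / ρ * dist z a := this
      _ ≤ 3 * ‖deriv h a‖ / ρ * (ρ / 6) := by gcongr
      _ = ‖deriv h a‖ / 2 := by field_simp; norm_num
  let e : ℂ ≃L[ℂ] ℂ := ContinuousLinearEquiv.unitsEquivAut ℂ (Units.mk0 _ h0)
  have he : ∀ x, e x = x * deriv h a := fun x => by simp [e]
  have happ : ApproximatesLinearOn h (e : ℂ →L[ℂ] ℂ) (closedBall a (ρ / 6))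
      (‖deriv h a‖₊ / 2) := by
    intro x hx y hy
    have hder : ∀ z ∈ closedBall a (ρ / 6),
        HasDerivWithinAt (fun z => h z - z * deriv h a) (deriv h z - deriv h a)
          (closedBall a (ρ / 6)) z := by
      intro z hz
      have h1 := (hh.differentiableAt (isOpen_ball.mem_nhds (hsub hz))).hasDerivAt
      have h2 := (hasDerivAt_id' z).mul_const (deriv h a)
      rw [one_mul] at h2
      exact (h1.sub h2).hasDerivWithinAt
    have := (convex_closedBall a (ρ / 6)).norm_image_sub_le_of_norm_hasDerivWithin_le hder key hy hx
    simp only [ContinuousLinearEquiv.coe_coe, he]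
    push_cast
    convert this using 2
    ring
  let N : (e : ℂ →L[ℂ] ℂ).NonlinearRightInverse := e.toNonlinearRightInverse
  have hN : (N.nnnorm : ℝ) = ‖deriv h a‖⁻¹ := by
    have : (N.nnnorm : ℝ) = ‖(e.symm : ℂ →L[ℂ] ℂ)‖ := rfl
    rw [this]
    have h1 : (e.symm : ℂ →L[ℂ] ℂ) = ContinuousLinearMap.smulRight (1 : ℂ →L[ℂ] ℂ) (deriv h a)⁻¹ := by
      ext
      simp [e]
    rw [h1, ContinuousLinearMap.norm_smulRight_apply]
    simp
  have hsurj := happ.surjOn_closedBall_of_nonlinearRightInverse N (b := a) (ε := ρ / 6)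
    (by positivity) subset_rfl
  intro y hy
  have : y ∈ closedBall (h a) (((N.nnnorm : ℝ)⁻¹ - (‖deriv h a‖₊ / 2 : NNReal)) * (ρ / 6)) := by
    rw [hN]
    convert hy using 2
    push_cast
    rw [inv_inv]
    ring
  exact image_mono hsub (hsurj this)

/-- **Bloch's theorem** with the constant `1/48`. -/
theorem exists_closedBall_subset_image {h : ℂ → ℂ} {c : ℂ} {R : ℝ} (hR : 0 < R)
    (hh : DifferentiableOn ℂ h (ball c R)) :
    ∃ p, closedBall p (R * ‖deriv h c‖ / 48) ⊆ h '' ball c R := by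
  rcases eq_or_ne (deriv h c) 0 with h0 | h0
  · refine ⟨h c, ?_⟩
    simp only [h0, norm_zero, mul_zero, zero_div, closedBall_zero, singleton_subset_iff]
    exact mem_image_of_mem _ (mem_ball_self hR)
  have hn : 0 < ‖deriv h c‖ := norm_pos_iff.2 h0
  have hd : DifferentiableOn ℂ (deriv h) (ball c R) := hh.deriv isOpen_ball
  have hsub : closedBall c (R / 2) ⊆ ball c R := closedBall_subset_ball (by linarith)
  have hcont : ContinuousOn (fun z => (R / 2 - dist z c) * ‖deriv h z‖) (closedBall c (R / 2)) :=
    (by fun_prop : Continuous fun z => R / 2 - dist z c).continuousOn.mul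
      (hd.continuousOn.mono hsub).norm
  -- Landau's choice of the centre: maximize `(R / 2 - |z - c|) |h'(z)|`.
  obtain ⟨a, ha, hmax⟩ := (isCompact_closedBall c (R / 2)).exists_isMaxOn
    ⟨c, mem_closedBall_self (by linarith)⟩ hcont
  have hmc := hmax (mem_closedBall_self (by linarith) : c ∈ closedBall c (R / 2))
  simp only [dist_self, sub_zero, mem_ofPred_eq] at hmc
  have hpos : 0 < (R / 2 - dist a c) * ‖deriv h a‖ := lt_of_lt_of_le (by positivity) hmc
  have hna : 0 ≤ ‖deriv h a‖ := norm_nonneg _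
  have hda : 0 < R / 2 - dist a c := pos_of_mul_pos_left hpos hna
  set ρ := (R / 2 - dist a c) / 2 with hρ
  have hρ0 : 0 < ρ := by positivity
  have hsub2 : ball a ρ ⊆ closedBall c (R / 2) := by
    intro z hz
    have := dist_triangle z a c
    rw [mem_ball] at hz
    rw [mem_closedBall]; linarith
  have hb : ∀ z ∈ ball a ρ, ‖deriv h z‖ ≤ 2 * ‖deriv h a‖ := by
    intro z hz
    have h1 := hmax (hsub2 hz)
    simp only [mem_ofPred_eq] at h1
    have := dist_triangle z a c
    rw [mem_ball] at hz
    have h2 : ρ * ‖deriv h z‖ ≤ (R / 2 - dist z c) * ‖deriv h z‖ := by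
      gcongr; linarith
    have h3 : ρ * ‖deriv h z‖ ≤ ρ * (2 * ‖deriv h a‖) := by
      calc _ ≤ _ := h2.trans h1
        _ = _ := by rw [hρ]; ring
    exact le_of_mul_le_mul_left h3 hρ0
  refine ⟨h a, ?_⟩
  refine (closedBall_subset_closedBall ?_).trans
    ((closedBall_subset_image_of_norm_deriv_le hρ0
      (hh.mono (hsub2.trans hsub)) hb).trans (image_mono (hsub2.trans hsub)))
  rw [hρ]
  linarith

/-- Holomorphic logarithms of zero-free functions on convex domains. -/
theorem exists_differentiableOn_exp_eq {U : Set ℂ} (hUc : Convex ℝ U) (hUo : IsOpen U)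
    (hU : U.Nonempty) {g : ℂ → ℂ} (hg : DifferentiableOn ℂ g U) (hne : ∀ z ∈ U, g z ≠ 0) :
    ∃ h : ℂ → ℂ, DifferentiableOn ℂ h U ∧ ∀ z ∈ U, Complex.exp (h z) = g z := by
  have := hUc.contractibleSpace hU
  have hsc : IsSimplyConnected U := SimplyConnectedSpace.ofContractible U
  obtain ⟨h, hhc, hexp⟩ := Complex.exists_continuousOn_eqOn_exp_comp hsc hUo hg.continuousOn
    (by rintro ⟨z, hz, h0⟩; exact hne z hz h0)
  refine ⟨h, fun z hz => ?_, fun z hz => hexp hz⟩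
  have hnhds := hUo.mem_nhds hz
  refine (differentiableAt_of_comp_eventuallyEq (F := Complex.exp) (h := g)
    (hhc.continuousAt hnhds) (by fun_prop) (by simp [Complex.exp_ne_zero])
    (hg.differentiableAt hnhds) ?_).differentiableWithinAt
  filter_upwards [hnhds] with x hx using hexp hx

/-- Weak form of **Koebe's one-quarter theorem**: a univalent function on a disc omits no value that
is close, in terms of its derivative, to its value at the centre. -/
theorem norm_deriv_le_of_injOn_of_notMem_image {g : ℂ → ℂ} {c b : ℂ} {R : ℝ} (hR : 0 < R)
    (hg : DifferentiableOn ℂ g (ball c R)) (hinj : InjOn g (ball c R))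
    (hb : b ∉ g '' ball c R) :
    R * ‖deriv g c‖ ≤ 48 * Real.pi * ‖g c - b‖ := by
  have hne : ∀ z ∈ ball c R, g z - b ≠ 0 := fun z hz h0 =>
    hb ⟨z, hz, sub_eq_zero.1 h0⟩
  have hc : c ∈ ball c R := mem_ball_self hR
  obtain ⟨h, hhd, hexp'⟩ := exists_differentiableOn_exp_eq (convex_ball c R) isOpen_ball ⟨c, hc⟩
    (hg.sub_const b) hne
  have hder : deriv g c = (g c - b) * deriv h c := by
    have h1 : g =ᶠ[𝓝 c] fun z => Complex.exp (h z) + b := by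
      filter_upwards [isOpen_ball.mem_nhds hc] with z hz
      rw [hexp' z hz]; ring
    rw [h1.deriv_eq]
    have h2 := ((hhd.differentiableAt (isOpen_ball.mem_nhds hc)).hasDerivAt.cexp).add_const b
    rw [h2.deriv, hexp' c hc]
  obtain ⟨p, hp⟩ := exists_closedBall_subset_image hR hhd
  have hlt : R * ‖deriv h c‖ / 48 < Real.pi := by
    -- A disc of radius `π` in the image of `h` would contain two values that differ by `2πi`.
    by_contra! hle
    have hmem : ∀ s : ℝ, |s| = 1 → p + s * Real.pi * Complex.I ∈ closedBall p (R * ‖deriv h c‖ / 48) := by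
      intro s hs
      rw [mem_closedBall, dist_eq_norm]
      simpa [hs, abs_of_pos Real.pi_pos] using hle
    obtain ⟨z₁, hz₁, h₁⟩ := hp (hmem 1 (by simp))
    obtain ⟨z₂, hz₂, h₂⟩ := hp (hmem (-1) (by simp))
    have heq : h z₁ = h z₂ + 2 * Real.pi * Complex.I := by
      rw [h₁, h₂]; push_cast; ring
    have : g z₁ = g z₂ := by
      have h3 := hexp' z₁ hz₁
      rw [heq, Complex.exp_add, Complex.exp_two_pi_mul_I, mul_one, hexp' z₂ hz₂] at h3
      linear_combination -h3
    have h12 := hinj hz₁ hz₂ this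
    rw [h12] at heq
    have : (2 * Real.pi * Complex.I : ℂ) = 0 := by linear_combination -heq
    exact Complex.two_pi_I_ne_zero this
  rw [hder, norm_mul]
  have h0 := norm_nonneg (g c - b)
  nlinarith [mul_le_mul_of_nonneg_right hlt.le h0]

theorem continuousAt_invFunOn {g : ℂ → ℂ} {U : Set ℂ} (hU : IsOpen U)
    (hg : DifferentiableOn ℂ g U) (hinj : InjOn g U) (hg' : ∀ z ∈ U, deriv g z ≠ 0)
    {x : ℂ} (hx : x ∈ U) : ContinuousAt (Function.invFunOn g U) (g x) := by
  have hmap : map g (𝓝 x) = 𝓝 (g x) :=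
    ((hg.analyticAt (hU.mem_nhds hx)).hasStrictDerivAt).map_nhds_eq (hg' x hx)
  rw [ContinuousAt, hinj.leftInvOn_invFunOn hx, ← hmap, tendsto_map'_iff]
  refine tendsto_id.congr' ?_
  filter_upwards [hU.mem_nhds hx] with y hy
  exact (hinj.leftInvOn_invFunOn hy).symm

/-- The Schwarz lemma for the inverse of a univalent function. -/
theorem le_norm_deriv_of_ball_subset_image {g : ℂ → ℂ} {c w : ℂ} {R δ : ℝ}
    (hg : DifferentiableOn ℂ g (ball c R)) (hinj : InjOn g (ball c R))
    (hg' : ∀ z ∈ ball c R, deriv g z ≠ 0) (hw : w ∈ ball c R)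
    (hδ : ball (g w) δ ⊆ g '' ball c R) : δ ≤ 2 * R * ‖deriv g w‖ := by
  have hR : 0 < R := (dist_nonneg).trans_lt hw
  rcases le_or_gt δ 0 with h0 | h0
  · exact h0.trans (by positivity)
  set k := Function.invFunOn g (ball c R)
  have hk : ∀ z ∈ ball c R, k (g z) = z := fun z hz => hinj.leftInvOn_invFunOn hz
  have hkm : ∀ y ∈ ball (g w) δ, k y ∈ ball c R ∧ g (k y) = y := by
    intro y hy
    obtain ⟨z, hz, rfl⟩ := hδ hy
    rw [hk z hz]; exact ⟨hz, rfl⟩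
  have hkd : DifferentiableOn ℂ k (ball (g w) δ) := by
    intro y hy
    obtain ⟨z, hz, rfl⟩ := hδ hy
    refine (differentiableAt_of_comp_eventuallyEq (F := g) (h := id)
      (continuousAt_invFunOn isOpen_ball hg hinj hg' hz) ?_ ?_ differentiableAt_id
      ?_).differentiableWithinAt
    · rw [show Function.invFunOn g (ball c R) (g z) = z from hk z hz]
      exact hg.analyticAt (isOpen_ball.mem_nhds hz)
    · rw [show Function.invFunOn g (ball c R) (g z) = z from hk z hz]
      exact hg' z hz
    · filter_upwards [isOpen_ball.mem_nhds hy] with x hx using (hkm x hx).2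
  have hmaps : MapsTo k (ball (g w) δ) (closedBall (k (g w)) (2 * R)) := by
    intro y hy
    rw [hk w hw, mem_closedBall]
    have := (hkm y hy).1
    rw [mem_ball] at this hw
    linarith [dist_triangle_right (k y) w c]
  have hS := Complex.norm_deriv_le_div_of_mapsTo_ball hkd hmaps h0
  have hchain : deriv k (g w) * deriv g w = 1 := by
    have h1 : HasDerivAt k (deriv k (g w)) (g w) :=
      (hkd.differentiableAt (isOpen_ball.mem_nhds (mem_ball_self h0))).hasDerivAt
    have h2 : HasDerivAt g (deriv g w) w :=
      (hg.differentiableAt (isOpen_ball.mem_nhds hw)).hasDerivAt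
    have h3 := h1.comp w h2
    have h4 : k ∘ g =ᶠ[𝓝 w] id := by
      filter_upwards [isOpen_ball.mem_nhds hw] with z hz using hk z hz
    exact h3.unique ((hasDerivAt_id w).congr_of_eventuallyEq h4)
  have hn : ‖deriv k (g w)‖ * ‖deriv g w‖ = 1 := by rw [← norm_mul, hchain, norm_one]
  have hp := norm_nonneg (deriv g w)
  have := mul_le_mul_of_nonneg_right hS hp
  rw [hn, div_mul_eq_mul_div, le_div_iff₀ h0] at this
  linarith

/-- A bound for the distortion of univalent functions on the disc with the same centre and `κ` times
the radius. It is not sharp. -/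
noncomputable def distortionConst (κ : ℝ) : ℝ :=
  96 * Real.pi / (1 - κ) * Real.exp (48 * Real.pi / (1 - κ))

theorem distortionConst_pos {κ : ℝ} (h1 : κ < 1) : 0 < distortionConst κ := by
  have : 0 < 1 - κ := by linarith
  have := Real.pi_pos
  unfold distortionConst; positivity

/-- **Bounded distortion**. The derivative of `g` is comparable with the distance `δ` of `g` to the
complement of the image; hence `δ` grows at most exponentially along segments, by Grönwall. -/
theorem norm_deriv_le_distortionConst_mul {g : ℂ → ℂ} {c b : ℂ} {R κ : ℝ} (hR : 0 < R)
    (hκ1 : κ < 1)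
    (hg : DifferentiableOn ℂ g (ball c R)) (hinj : InjOn g (ball c R))
    (hg' : ∀ z ∈ ball c R, deriv g z ≠ 0) (hb : b ∉ g '' ball c R) {x y : ℂ}
    (hx : x ∈ closedBall c (κ * R)) (hy : y ∈ closedBall c (κ * R)) (hxy : ‖y - x‖ ≤ R) :
    ‖deriv g y‖ ≤ distortionConst κ * ‖deriv g x‖ := by
  have hκ : 0 < 1 - κ := by linarith
  have hπ := Real.pi_pos
  have hsub : closedBall c (κ * R) ⊆ ball c R := closedBall_subset_ball (by nlinarith)
  set δ : ℂ → ℝ := fun w => infDist (g w) (g '' ball c R)ᶜ with hδdef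
  have hne : ((g '' ball c R)ᶜ).Nonempty := ⟨b, hb⟩
  set M : ℝ := 48 * Real.pi / ((1 - κ) * R) with hM
  have hM0 : 0 ≤ M := by positivity
  have hup : ∀ w ∈ closedBall c (κ * R), ‖deriv g w‖ ≤ M * δ w := by
    intro w hw
    have hwR : ball w ((1 - κ) * R) ⊆ ball c R := by
      apply ball_subset_ball'
      rw [mem_closedBall] at hw
      linarith
    have h1 : (1 - κ) * R * ‖deriv g w‖ / (48 * Real.pi) ≤ δ w := by
      rw [hδdef]
      refine (le_infDist hne).2 fun b' hb' => ?_
      rw [div_le_iff₀ (by positivity), dist_eq_norm, mul_comm ‖_‖]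
      exact norm_deriv_le_of_injOn_of_notMem_image (by positivity) (hg.mono hwR) (hinj.mono hwR)
        fun h => hb' (image_mono hwR h)
    rw [div_le_iff₀ (by positivity)] at h1
    rw [hM, div_mul_eq_mul_div, le_div_iff₀ (by positivity)]
    linarith
  have hlow : ∀ w ∈ closedBall c (κ * R), δ w ≤ 2 * R * ‖deriv g w‖ := fun w hw =>
    le_norm_deriv_of_ball_subset_image hg hinj hg' (hsub hw) ball_infDist_compl_subset
  have hgrow : δ y ≤ δ x * Real.exp (48 * Real.pi / (1 - κ)) := by
    set u : ℝ → ℂ := fun t => g (x + t * (y - x)) - g x with hu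
    have hseg : ∀ t ∈ Icc (0 : ℝ) 1, x + t * (y - x) ∈ closedBall c (κ * R) := by
      intro t ht
      have := (convex_closedBall c (κ * R)).add_smul_sub_mem hx hy ht
      simpa using this
    have hderu : ∀ t ∈ Icc (0 : ℝ) 1,
        HasDerivAt u (deriv g (x + t * (y - x)) * (y - x)) t := by
      intro t ht
      have h1 := (hg.differentiableAt (isOpen_ball.mem_nhds (hsub (hseg t ht)))).hasDerivAt
      have h2 : HasDerivAt (fun s : ℝ => x + (s : ℂ) * (y - x)) (y - x) t := by
        have h3 : HasDerivAt (fun s : ℝ => (s : ℂ)) 1 t := Complex.ofRealCLM.hasDerivAt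
        simpa using (h3.mul_const (y - x)).const_add x
      exact (h1.comp t h2).sub_const _
    have hG := norm_le_gronwallBound_of_norm_deriv_right_le (f := u)
      (f' := fun t => deriv g (x + t * (y - x)) * (y - x)) (δ := 0) (K := M * R)
      (ε := M * R * δ x) (a := 0) (b := 1)
      (fun t ht => (hderu t ht).continuousAt.continuousWithinAt)
      (fun t ht => (hderu t (Ico_subset_Icc_self ht)).hasDerivWithinAt) (by simp [hu])
      (by
        intro t ht
        have ht' := Ico_subset_Icc_self ht
        have h1 := hup _ (hseg t ht')
        have h2 : δ (x + t * (y - x)) ≤ δ x + ‖u t‖ := by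
          have := infDist_le_infDist_add_dist (s := (g '' ball c R)ᶜ)
            (x := g (x + t * (y - x))) (y := g x)
          rwa [dist_eq_norm] at this
        rw [norm_mul]
        calc ‖deriv g (x + t * (y - x))‖ * ‖y - x‖ ≤ (M * (δ x + ‖u t‖)) * R := by
              gcongr
              · exact (norm_nonneg _).trans (h1.trans (by gcongr))
              · exact h1.trans (by gcongr)
          _ = M * R * ‖u t‖ + M * R * δ x := by ring)
      1 ⟨by norm_num, le_rfl⟩
    have hMR : M * R = 48 * Real.pi / (1 - κ) := by
      rw [hM]; field_simp
    have hMR0 : M * R ≠ 0 := by rw [hMR]; positivity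
    rw [gronwallBound_of_K_ne_0 hMR0] at hG
    have h3 : δ y ≤ δ x + ‖u 1‖ := by
      have := infDist_le_infDist_add_dist (s := (g '' ball c R)ᶜ) (x := g y) (y := g x)
      rw [dist_eq_norm] at this
      simpa [hu] using this
    have h4 : M * R * δ x / (M * R) = δ x := mul_div_cancel_left₀ _ hMR0
    rw [h4] at hG
    rw [← hMR]
    simp only [sub_zero, mul_one, zero_mul, zero_add] at hG
    linarith
  calc ‖deriv g y‖ ≤ M * δ y := hup y hy
    _ ≤ M * (δ x * Real.exp (48 * Real.pi / (1 - κ))) := by gcongr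
    _ ≤ M * ((2 * R * ‖deriv g x‖) * Real.exp (48 * Real.pi / (1 - κ))) := by
        gcongr; exact hlow x hx
    _ = distortionConst κ * ‖deriv g x‖ := by
        rw [hM, distortionConst]; field_simp; ring

/-! ### Lifting through `f` over the exterior of a disc -/

/-- The restriction of `f` to the set where `‖f‖ > r₀`; it is a local homeomorphism if there are no
critical values outside the disc of radius `r₀`. -/
def outerRestrict (f : ℂ → ℂ) (r₀ : ℝ) (z : {z : ℂ // r₀ < ‖f z‖}) : ℂ := f z

theorem isLocalHomeomorph_outerRestrict (hf : Differentiable ℂ f)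
    (hcrit : ∀ a, r₀ < ‖f a‖ → deriv f a ≠ 0) : IsLocalHomeomorph (outerRestrict f r₀) := by
  have h1 : IsLocalHomeomorphOn f {z | r₀ < ‖f z‖} := by
    refine IsLocalHomeomorphOn.mk f _ fun x hx => ?_
    have hs : HasStrictDerivAt f (deriv f x) x := (hf.analyticAt x).hasStrictDerivAt
    have hs' := hs.hasStrictFDerivAt_equiv (hcrit x hx)
    exact ⟨hs'.toOpenPartialHomeomorph f, hs'.mem_toOpenPartialHomeomorph_source, fun _ _ => rfl⟩
  have hopen : IsOpen {z | r₀ < ‖f z‖} := isOpen_lt continuous_const hf.continuous.norm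
  have h2 : IsLocalHomeomorph (Subtype.val : {z : ℂ // r₀ < ‖f z‖} → ℂ) :=
    hopen.isOpenEmbedding_subtypeVal.isLocalHomeomorph
  rw [isLocalHomeomorph_iff_isLocalHomeomorphOn_univ] at h2 ⊢
  exact h1.comp h2 fun x _ => x.2

/-- The path `β` has a lift through `f` starting at `z` and defined up to the time `T`. Lifts take
values in `{‖f‖ > r₀}`; outside `[0, T]` the map `γ` is arbitrary. -/
def HasLiftUpTo (f : ℂ → ℂ) (r₀ : ℝ) (β : ℝ → ℂ) (z : {z : ℂ // r₀ < ‖f z‖}) (T : ℝ) : Prop :=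
  ∃ γ : ℝ → {z : ℂ // r₀ < ‖f z‖}, ContinuousOn γ (Icc 0 T) ∧ γ 0 = z ∧
    ∀ t ∈ Icc 0 T, outerRestrict f r₀ (γ t) = β t

/-- A lift up to time `s` is continued by a local inverse `e.symm` of `f`. -/
theorem HasLiftUpTo.glue {β : ℝ → ℂ} (hβ : Continuous β) {z : {z : ℂ // r₀ < ‖f z‖}} {s T : ℝ}
    (hs : 0 ≤ s) (hsT : s ≤ T) {γ : ℝ → {z : ℂ // r₀ < ‖f z‖}} (hγ : ContinuousOn γ (Icc 0 s))
    (hγ0 : γ 0 = z) (hγβ : ∀ t ∈ Icc 0 s, outerRestrict f r₀ (γ t) = β t)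
    (e : OpenPartialHomeomorph {z : ℂ // r₀ < ‖f z‖} ℂ) (he : outerRestrict f r₀ = e)
    (hes : γ s ∈ e.source) (heT : ∀ t ∈ Icc s T, β t ∈ e.target) :
    HasLiftUpTo f r₀ β z T := by
  classical
  have hss : e.symm (β s) = γ s := by
    rw [← hγβ s ⟨hs, le_rfl⟩, he, e.left_inv hes]
  set γ' : ℝ → {z : ℂ // r₀ < ‖f z‖} := fun t => if t ≤ s then γ t else e.symm (β t) with hγ'
  have h1 : ∀ t ∈ Icc 0 s, γ' t = γ t := fun t ht => by simp [hγ', ht.2]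
  have h2 : ∀ t ∈ Icc s T, γ' t = e.symm (β t) := by
    intro t ht
    rcases ht.1.eq_or_lt with rfl | hlt
    · simp [hγ', hss]
    · simp [hγ', not_le.2 hlt]
  refine ⟨γ', ?_, ?_, ?_⟩
  · rw [← Icc_union_Icc_eq_Icc hs hsT]
    refine ContinuousOn.union_of_isClosed (hγ.congr h1) (ContinuousOn.congr ?_ h2)
      isClosed_Icc isClosed_Icc
    exact e.continuousOn_symm.comp hβ.continuousOn heT
  · rw [h1 0 ⟨le_rfl, hs⟩, hγ0]
  · intro t ht
    rcases le_total t s with h | h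
    · rw [h1 t ⟨ht.1, h⟩, hγβ t ⟨ht.1, h⟩]
    · rw [h2 t ⟨h, ht.2⟩, he, e.right_inv (heT t ⟨h, ht.2⟩)]

theorem HasLiftUpTo.mono {β : ℝ → ℂ} {z : {z : ℂ // r₀ < ‖f z‖}} {s T : ℝ} (hsT : s ≤ T)
    (h : HasLiftUpTo f r₀ β z T) : HasLiftUpTo f r₀ β z s := by
  obtain ⟨γ, h1, h2, h3⟩ := h
  exact ⟨γ, h1.mono (Icc_subset_Icc_right hsT), h2, fun t ht => h3 t ⟨ht.1, ht.2.trans hsT⟩⟩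

theorem HasLiftUpTo.exists_gt (hf : Differentiable ℂ f)
    (hcrit : ∀ a, r₀ < ‖f a‖ → deriv f a ≠ 0) {β : ℝ → ℂ} (hβ : Continuous β)
    {z : {z : ℂ // r₀ < ‖f z‖}} {s y : ℝ} (hs : 0 ≤ s) (hsy : s < y)
    (h : HasLiftUpTo f r₀ β z s) : ∃ T ∈ Ioc s y, HasLiftUpTo f r₀ β z T := by
  obtain ⟨γ, h1, h2, h3⟩ := h
  obtain ⟨e, hes, he⟩ := isLocalHomeomorph_outerRestrict hf hcrit (γ s)
  have hmem : β s ∈ e.target := by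
    rw [← h3 s ⟨hs, le_rfl⟩, he]; exact e.map_source hes
  have hev : ∀ᶠ t in 𝓝 s, β t ∈ e.target :=
    hβ.continuousAt.eventually (e.open_target.mem_nhds hmem)
  obtain ⟨ε, hε, hball⟩ := Metric.eventually_nhds_iff.1 hev
  refine ⟨min y (s + ε / 2), ⟨lt_min hsy (by linarith), min_le_left _ _⟩, ?_⟩
  refine HasLiftUpTo.glue hβ hs (le_min hsy.le (by linarith)) h1 h2 h3 e he hes fun t ht => hball ?_
  rw [Real.dist_eq, abs_of_nonneg (by linarith [ht.1])]
  linarith [ht.2.trans (min_le_right _ _)]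

/-- The limit step of path lifting. If the lift tends to `∞` then `β T` is an asymptotic value;
otherwise the lift has a finite cluster point, and a local inverse there continues it. -/
theorem HasLiftUpTo.of_forall_lt (hf : Differentiable ℂ f)
    (hcrit : ∀ a, r₀ < ‖f a‖ → deriv f a ≠ 0) (hasy : ∀ b ∈ asymptoticValues f, ‖b‖ ≤ r₀)
    {β : ℝ → ℂ} (hβ : Continuous β)
    {z : {z : ℂ // r₀ < ‖f z‖}} {T : ℝ} (hT : 0 < T) (hβT : r₀ < ‖β T‖)
    (h : ∀ s ∈ Ico 0 T, HasLiftUpTo f r₀ β z s) : HasLiftUpTo f r₀ β z T := by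
  have hloc := isLocalHomeomorph_outerRestrict hf hcrit
  have hsep := T2Space.isSeparatedMap (outerRestrict f r₀)
  have : Nonempty {z : ℂ // r₀ < ‖f z‖} := ⟨z⟩
  choose! γ hγc hγ0 hγβ using h
  set Γ : ℝ → {z : ℂ // r₀ < ‖f z‖} := fun t => γ t t with hΓ
  have hagree : ∀ s ∈ Ico 0 T, ∀ t ∈ Icc 0 s, Γ t = γ s t := by
    intro s hs t ht
    have htT : t ∈ Ico 0 T := ⟨ht.1, ht.2.trans_lt hs.2⟩
    refine hsep.eqOn_of_comp_eqOn hloc.isLocallyInjective (isPreconnected_Icc (a := 0) (b := t))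
      (hγc t htT) ((hγc s hs).mono (Icc_subset_Icc_right ht.2)) ?_ (a := 0) ⟨le_rfl, ht.1⟩ ?_
      ⟨ht.1, le_rfl⟩
    · intro u hu
      simp only [Function.comp_apply]
      rw [hγβ t htT u hu, hγβ s hs u ⟨hu.1, hu.2.trans ht.2⟩]
    · rw [hγ0 t htT, hγ0 s hs]
  have hΓβ : ∀ t ∈ Ico 0 T, f (Γ t) = β t := fun t ht => hγβ t ht t ⟨ht.1, le_rfl⟩
  have hΓ0 : Γ 0 = z := hγ0 0 ⟨le_rfl, hT⟩
  have hΓc : ∀ s ∈ Ico 0 T, ContinuousOn Γ (Icc 0 s) := fun s hs =>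
    (hγc s hs).congr (hagree s hs)
  have hIco : ∀ᶠ t in 𝓝[<] T, t ∈ Ico 0 T := by
    filter_upwards [Ioo_mem_nhdsLT hT] with t ht using ⟨ht.1.le, ht.2⟩
  by_cases hinf : Tendsto (fun t => (Γ t : ℂ)) (𝓝[<] T) (Bornology.cobounded ℂ)
  · exfalso
    refine (hasy (β T) ?_).not_gt hβT
    -- Reparametrize `[0, T)` by `[0, ∞)` to turn the lift into an asymptotic path.
    set q : ℝ → ℝ := fun u => T - T / (1 + u) with hq
    have hqm : ∀ u ∈ Ici (0 : ℝ), q u ∈ Ico 0 T := by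
      intro u hu
      have hu' : 0 ≤ u := hu
      have h1 : T / (1 + u) ≤ T := div_le_self hT.le (by linarith)
      have h2 : 0 < T / (1 + u) := by positivity
      exact ⟨by simp only [hq]; linarith, by simp only [hq]; linarith⟩
    have hqT : Tendsto q atTop (𝓝 T) := by
      have : Tendsto (fun u : ℝ => T / (1 + u)) atTop (𝓝 0) :=
        Tendsto.div_atTop tendsto_const_nhds (tendsto_atTop_add_const_left _ _ tendsto_id)
      simpa [hq] using tendsto_const_nhds.sub this
    have hqT' : Tendsto q atTop (𝓝[<] T) := by
      refine tendsto_nhdsWithin_iff.2 ⟨hqT, ?_⟩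
      filter_upwards [eventually_ge_atTop 0] with u hu using (hqm u hu).2
    have hqc : ContinuousOn q (Ici 0) := by
      refine continuousOn_const.sub (continuousOn_const.div (by fun_prop) fun u hu => ?_)
      have hu' : 0 ≤ u := hu
      positivity
    have hΓIco : ContinuousOn Γ (Ico 0 T) := by
      intro t ht
      obtain ⟨s, hts, hsT⟩ := exists_between ht.2
      have hs0 : 0 ≤ s := ht.1.trans hts.le
      refine ((hΓc s ⟨hs0, hsT⟩) t ⟨ht.1, hts.le⟩).mono_of_mem_nhdsWithin ?_
      refine mem_nhdsWithin.2 ⟨Iio s, isOpen_Iio, hts, fun u hu => ⟨hu.2.1, le_of_lt hu.1⟩⟩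
    refine ⟨fun u => (Γ (q u) : ℂ), ?_, hinf.comp hqT', ?_⟩
    · exact continuous_subtype_val.comp_continuousOn (hΓIco.comp hqc hqm)
    · refine ((hβ.tendsto T).comp hqT).congr' ?_
      filter_upwards [eventually_ge_atTop 0] with u hu
      exact (hΓβ _ (hqm u hu)).symm
  · rw [← tendsto_norm_atTop_iff_cobounded, Filter.tendsto_atTop] at hinf
    push Not at hinf
    obtain ⟨R, hR⟩ := hinf
    have hfreq : ∃ᶠ t in 𝓝[<] T, (Γ t : ℂ) ∈ closedBall (0 : ℂ) R := by
      refine hR.mono fun t ht => ?_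
      rw [mem_closedBall_zero_iff]; exact ht.le
    obtain ⟨a, -, ha⟩ := (isCompact_closedBall (0 : ℂ) R).exists_mapClusterPt_of_frequently hfreq
    have hfa : f a = β T := by
      have h1 : MapClusterPt (f a) (𝓝[<] T) (fun t => f (Γ t)) :=
        ha.continuousAt_comp hf.continuous.continuousAt
      have h2 : Tendsto (fun t => f (Γ t)) (𝓝[<] T) (𝓝 (β T)) := by
        refine ((hβ.tendsto T).mono_left nhdsWithin_le_nhds).congr' ?_
        filter_upwards [hIco] with t ht using (hΓβ t ht).symm
      by_contra hne
      obtain ⟨U, V, hU, hV, haU, haV, hd⟩ := t2_separation hne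
      obtain ⟨t, ht1, ht2⟩ := ((mapClusterPt_iff_frequently.1 h1 U (hU.mem_nhds haU)).and_eventually
        (h2.eventually (hV.mem_nhds haV))).exists
      exact hd.le_bot ⟨ht1, ht2⟩
    set a' : {z : ℂ // r₀ < ‖f z‖} := ⟨a, by rw [hfa]; exact hβT⟩ with ha'
    obtain ⟨e, hes, he⟩ := hloc a'
    have hmem : β T ∈ e.target := by
      have : e a' = β T := by rw [← he]; exact hfa
      rw [← this]; exact e.map_source hes
    have hev : ∀ᶠ t in 𝓝 T, β t ∈ e.target :=
      hβ.continuousAt.eventually (e.open_target.mem_nhds hmem)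
    obtain ⟨ε, hε, hball⟩ := Metric.eventually_nhds_iff.1 hev
    obtain ⟨V, hV, hVe⟩ := (mem_nhds_subtype _ a' _).1 (e.open_source.mem_nhds hes)
    obtain ⟨s, hsV, hs, hsε⟩ := ((mapClusterPt_iff_frequently.1 ha V hV).and_eventually
      (hIco.and (Ioo_mem_nhdsLT (show T - ε < T by linarith)))).exists
    refine HasLiftUpTo.glue hβ hs.1 hs.2.le (hΓc s hs) hΓ0
      (fun t ht => hΓβ t ⟨ht.1, ht.2.trans_lt hs.2⟩) e he (hVe hsV) fun t ht => hball ?_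
    rw [Real.dist_eq, abs_lt]
    constructor <;> linarith [ht.1, ht.2, hsε.1]

theorem hasLiftUpTo_one (hf : Differentiable ℂ f)
    (hcrit : ∀ a, r₀ < ‖f a‖ → deriv f a ≠ 0) (hasy : ∀ b ∈ asymptoticValues f, ‖b‖ ≤ r₀)
    {β : ℝ → ℂ} (hβ : Continuous β) (hβr : ∀ t ∈ Icc (0 : ℝ) 1, r₀ < ‖β t‖)
    (z : {z : ℂ // r₀ < ‖f z‖}) (hz : f z = β 0) : HasLiftUpTo f r₀ β z 1 := by
  have h0 : HasLiftUpTo f r₀ β z 0 := by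
    refine ⟨fun _ => z, continuousOn_const, rfl, fun t ht => ?_⟩
    rw [Icc_self, mem_singleton_iff] at ht
    rw [ht]; exact hz
  have hclosed : IsClosed ({T | HasLiftUpTo f r₀ β z T} ∩ Icc 0 1) := by
    refine isClosed_of_closure_subset fun T hT => ?_
    have hTI : T ∈ Icc (0 : ℝ) 1 :=
      isClosed_Icc.closure_subset (closure_mono inter_subset_right hT)
    refine ⟨?_, hTI⟩
    rcases hTI.1.eq_or_lt with rfl | hpos
    · exact h0
    · refine HasLiftUpTo.of_forall_lt hf hcrit hasy hβ hpos (hβr T hTI) fun s hs => ?_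
      obtain ⟨y, hy, hyT⟩ := Metric.mem_closure_iff.1 hT (T - s) (by linarith [hs.2])
      rw [Real.dist_eq, abs_lt] at hyT
      exact HasLiftUpTo.mono (by linarith [hyT.2]) hy.1
  have := hclosed.Icc_subset_of_forall_exists_gt h0 fun x hx y hy => by
    obtain ⟨T, hT, hL⟩ := HasLiftUpTo.exists_gt hf hcrit hβ hx.2.1 hy hx.1
    exact ⟨T, hL, hT⟩
  exact this ⟨zero_le_one, le_rfl⟩

/-- Lifts along the segments from `w₀` fit together to a holomorphic lift on the convex domain `U`. -/
theorem exists_holomorphic_lift (hf : Differentiable ℂ f)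
    (hcrit : ∀ a, r₀ < ‖f a‖ → deriv f a ≠ 0) (hasy : ∀ b ∈ asymptoticValues f, ‖b‖ ≤ r₀)
    {U : Set ℂ} (hUo : IsOpen U) (hUc : Convex ℝ U) {h : ℂ → ℂ} (hh : Differentiable ℂ h)
    (hhU : ∀ w ∈ U, r₀ < ‖h w‖) {w₀ z : ℂ} (hw₀ : w₀ ∈ U) (hz : f z = h w₀) :
    ∃ φ : ℂ → ℂ, DifferentiableOn ℂ φ U ∧ φ w₀ = z ∧ ∀ w ∈ U, f (φ w) = h w := by
  classical
  have hloc := isLocalHomeomorph_outerRestrict hf hcrit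
  have hsep := T2Space.isSeparatedMap (outerRestrict f r₀)
  set z' : {z : ℂ // r₀ < ‖f z‖} := ⟨z, by rw [hz]; exact hhU w₀ hw₀⟩
  have hseg : ∀ a ∈ U, ∀ t ∈ Icc (0 : ℝ) 1, w₀ + t * (a - w₀) ∈ U := by
    intro a ha t ht
    simpa using hUc.add_smul_sub_mem hw₀ ha ht
  have hlift : ∀ a : U, HasLiftUpTo f r₀ (fun t : ℝ => h (w₀ + t * (a - w₀))) z' 1 := by
    intro a
    refine hasLiftUpTo_one hf hcrit hasy ?_ (fun t ht => hhU _ (hseg a a.2 t ht)) z' ?_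
    · exact hh.continuous.comp (by fun_prop)
    · simpa using hz
  choose γ hγc hγ0 hγβ using hlift
  let F : C(unitInterval × U, ℂ) :=
    ⟨fun x => h (w₀ + (x.1 : ℝ) * (x.2 - w₀)), hh.continuous.comp (by fun_prop)⟩
  have hg : Continuous (fun x : unitInterval × U => γ x.2 x.1) := by
    refine hloc.continuous_lift hsep F ?_ ?_ ?_
    · ext x
      exact hγβ x.2 x.1 x.1.2
    · have : (fun a : U => γ a ((0 : unitInterval) : ℝ)) = fun _ => z' := by
        funext a; simpa using hγ0 a
      exact this ▸ continuous_const
    · intro a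
      exact (hγc a).comp_continuous continuous_subtype_val fun t => t.2
  set φ : ℂ → ℂ := fun w => if hw : w ∈ U then (γ ⟨w, hw⟩ 1 : ℂ) else 0 with hφ
  have hφU : ∀ w (hw : w ∈ U), φ w = γ ⟨w, hw⟩ 1 := fun w hw => by simp [hφ, hw]
  have hfφ : ∀ w ∈ U, f (φ w) = h w := by
    intro w hw
    rw [hφU w hw]
    have := hγβ ⟨w, hw⟩ 1 ⟨zero_le_one, le_rfl⟩
    simpa [outerRestrict] using this
  have hφc : ContinuousOn φ U := by
    rw [continuousOn_iff_continuous_domRestrict]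
    have h1 : U.domRestrict φ = fun a : U => (γ a ((1 : unitInterval) : ℝ) : ℂ) := by
      funext a
      simp [Set.domRestrict, hφU a a.2]
    rw [h1]
    exact continuous_subtype_val.comp (hg.comp (by fun_prop : Continuous fun a : U => ((1 : unitInterval), a)))
  refine ⟨φ, fun w hw => ?_, ?_, hfφ⟩
  · refine (differentiableAt_of_comp_eventuallyEq (F := f) (h := h)
      (hφc.continuousAt (hUo.mem_nhds hw)) (hf.analyticAt _) (hcrit _ ?_) (hh w)
      ?_).differentiableWithinAt
    · rw [hfφ w hw]; exact hhU w hw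
    · filter_upwards [hUo.mem_nhds hw] with x hx using hfφ x hx
  · rw [hφU w₀ hw₀]
    have hconst := hsep.constOn_of_comp hloc.isLocallyInjective
      (isPreconnected_Icc (a := (0 : ℝ)) (b := 1)) (hγc ⟨w₀, hw₀⟩) (fun a ha b hb => by
        rw [hγβ _ a ha, hγβ _ b hb]; simp) (a := 1) (a' := 0) ⟨zero_le_one, le_rfl⟩ ⟨le_rfl, zero_le_one⟩
    rw [hconst, hγ0]

/-! ### Univalent inverse branches on a half plane -/

/-- The properties of `f` that make it a covering of `{‖z‖ > r₀}` whose logarithmic lifts are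
univalent: there are no critical or asymptotic values outside the disc of radius `r₀`, points
of this disc are mapped into it, and `f` has values in it at points arbitrarily near `∞`. -/
structure IsExteriorCovering (f : ℂ → ℂ) (r₀ : ℝ) : Prop where
  differentiable : Differentiable ℂ f
  pos : 0 < r₀
  deriv_ne_zero : ∀ a, r₀ < ‖f a‖ → deriv f a ≠ 0
  norm_le_of_asymptotic : ∀ b ∈ asymptoticValues f, ‖b‖ ≤ r₀
  lt_norm : ∀ u, r₀ < ‖f u‖ → r₀ < ‖u‖
  frequently_le : ∃ᶠ u in Bornology.cobounded ℂ, ‖f u‖ ≤ r₀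

/-- The half plane `{Re w > log r₀}`, which `exp` maps onto `{‖z‖ > r₀}`. -/
def logHalfPlane (r₀ : ℝ) : Set ℂ := {w | Real.log r₀ < w.re}


theorem isOpen_logHalfPlane (r₀ : ℝ) : IsOpen (logHalfPlane r₀) :=
  isOpen_lt continuous_const Complex.continuous_re

theorem convex_logHalfPlane (r₀ : ℝ) : Convex ℝ (logHalfPlane r₀) :=
  convex_halfSpace_re_gt _

theorem lt_norm_exp_iff (hr : 0 < r₀) (w : ℂ) :
    r₀ < ‖Complex.exp w‖ ↔ w ∈ logHalfPlane r₀ := by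
  rw [Complex.norm_exp, ← Real.log_lt_iff_lt_exp hr]; rfl

/-- If a lift of `exp` through `f` takes the same value at two points that differ by a period `τ` of
`exp`, then it has the period `τ`: both `φ` and its translate are lifts of `exp`. -/
theorem eqOn_translate (hc : IsExteriorCovering f r₀) {φ : ℂ → ℂ}
    (hφ : DifferentiableOn ℂ φ (logHalfPlane r₀))
    (hfφ : ∀ w ∈ logHalfPlane r₀, f (φ w) = Complex.exp w) {τ w₀ : ℂ} (hτ : τ.re = 0)
    (hτe : Complex.exp τ = 1) (hw₀ : w₀ ∈ logHalfPlane r₀) (h : φ (w₀ + τ) = φ w₀) :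
    ∀ w ∈ logHalfPlane r₀, φ (w + τ) = φ w := by
  have hmem : ∀ w ∈ logHalfPlane r₀, w + τ ∈ logHalfPlane r₀ := by
    intro w hw
    simpa [logHalfPlane, hτ] using hw
  have hψ : DifferentiableOn ℂ (fun w => φ (w + τ)) (logHalfPlane r₀) :=
    hφ.comp (by fun_prop) hmem
  have ho := isOpen_logHalfPlane r₀
  have hs : HasStrictDerivAt f (deriv f (φ w₀)) (φ w₀) :=
    (hc.differentiable.analyticAt _).hasStrictDerivAt
  have hne : deriv f (φ w₀) ≠ 0 := hc.deriv_ne_zero _ (by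
    rw [hfφ w₀ hw₀]; exact (lt_norm_exp_iff hc.pos _).2 hw₀)
  have hl := hs.eventually_left_inverse hne
  have h1 : ContinuousAt φ w₀ := hφ.continuousOn.continuousAt (ho.mem_nhds hw₀)
  have h2 : Tendsto (fun w => φ (w + τ)) (𝓝 w₀) (𝓝 (φ w₀)) := by
    have : ContinuousAt (fun w => φ (w + τ)) w₀ := hψ.continuousOn.continuousAt (ho.mem_nhds hw₀)
    rw [ContinuousAt, h] at this
    exact this
  have hev : (fun w => φ (w + τ)) =ᶠ[𝓝 w₀] φ := by
    filter_upwards [h1.eventually hl, h2.eventually hl, ho.mem_nhds hw₀] with w hw hw' hwH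
    rw [← hw, ← hw', hfφ w hwH, hfφ _ (hmem w hwH), Complex.exp_add, hτe, mul_one]
  exact (hψ.analyticOnNhd ho).eqOn_of_preconnected_of_eventuallyEq (hφ.analyticOnNhd ho)
    (convex_logHalfPlane r₀).isPreconnected hw₀ hev

/-- A periodic lift `φ` is a function of `q = e^{-2πw/h}` near `q = 0`. There
`1/φ` extends holomorphically by `0`, so it takes all small values by the open mapping theorem.
Hence all points near `∞` are values of `φ`, and `‖f‖ > r₀` at these. -/
theorem not_periodic_lift (hc : IsExteriorCovering f r₀) {φ : ℂ → ℂ}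
    (hφ : DifferentiableOn ℂ φ (logHalfPlane r₀))
    (hfφ : ∀ w ∈ logHalfPlane r₀, f (φ w) = Complex.exp w) {h : ℝ} (hh : 0 < h)
    (hper : ∀ w ∈ logHalfPlane r₀, φ (w - h * Complex.I) = φ w) : False := by
  classical
  set L := Real.log r₀ with hL
  have hmem : ∀ z : ℂ, L < z.im ↔ -Complex.I * z ∈ logHalfPlane r₀ := by
    intro z; simp [logHalfPlane, ← hL]
  have hφ0 : ∀ w ∈ logHalfPlane r₀, φ w ≠ 0 := by
    intro w hw h0
    have := hc.lt_norm (φ w) (by rw [hfφ w hw]; exact (lt_norm_exp_iff hc.pos _).2 hw)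
    rw [h0, norm_zero] at this
    linarith [hc.pos]
  -- Rotated so that the period is real, as `Function.Periodic.cuspFunction` requires.
  set g : ℂ → ℂ := fun z => if L < z.im then (φ (-Complex.I * z))⁻¹ else 0 with hg
  have hgper : Function.Periodic g (h : ℂ) := by
    intro z
    simp only [hg, Complex.add_im, Complex.ofReal_im, add_zero]
    split_ifs with hz
    · rw [← hper _ ((hmem z).1 hz)]
      congr 2; ring
    · rfl
  have hI : ∀ B : ℝ, ∀ᶠ z in comap Complex.im atTop, B < z.im := fun B =>
    tendsto_comap.eventually (eventually_gt_atTop B)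
  have hhol : ∀ᶠ z in comap Complex.im atTop, DifferentiableAt ℂ g z := by
    filter_upwards [hI L] with z hz
    have hev : g =ᶠ[𝓝 z] fun z => (φ (-Complex.I * z))⁻¹ := by
      filter_upwards [(isOpen_lt continuous_const Complex.continuous_im).mem_nhds hz] with y hy
      simp only [hg]; exact if_pos hy
    rw [hev.differentiableAt_iff]
    have hw := (hmem z).1 hz
    have hd : DifferentiableAt ℂ φ (-Complex.I * z) :=
      hφ.differentiableAt ((isOpen_logHalfPlane r₀).mem_nhds hw)
    exact (hd.comp z (by fun_prop : DifferentiableAt ℂ (fun z => -Complex.I * z) z)).inv (hφ0 _ hw)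
  have hzero : Filter.ZeroAtFilter (comap Complex.im atTop) g := by
    rw [Filter.ZeroAtFilter, tendsto_zero_iff_norm_tendsto_zero]
    refine Metric.tendsto_nhds.2 fun ε hε => ?_
    obtain ⟨M, hM⟩ := (isCompact_closedBall (0 : ℂ) ε⁻¹).exists_bound_of_continuousOn
      hc.differentiable.continuous.continuousOn
    filter_upwards [hI L, hI (Real.log (max M 1))] with z hz hz'
    have hw := (hmem z).1 hz
    simp only [hg, if_pos hz, norm_inv, dist_zero_right, norm_norm]
    have hlt : ε⁻¹ < ‖φ (-Complex.I * z)‖ := by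
      by_contra! hle
      have h1 := hM _ (mem_closedBall_zero_iff.2 hle)
      rw [hfφ _ hw, Complex.norm_exp] at h1
      rw [Real.log_lt_iff_lt_exp (by positivity)] at hz'
      have : (-Complex.I * z).re = z.im := by simp
      rw [this] at h1
      linarith [le_max_left M 1]
    exact inv_lt_of_inv_lt₀ hε hlt
  set Q := Function.Periodic.cuspFunction h g with hQ
  have hQ0 : Q 0 = 0 := Function.Periodic.cuspFunction_zero_of_zero_at_inf hh hzero
  have hQd : ∀ᶠ q in 𝓝 (0 : ℂ), DifferentiableAt ℂ Q q := by
    have h1 := Function.Periodic.eventually_differentiableAt_cuspFunction_nhds_ne_zero hh hgper hhol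
    have h2 := Function.Periodic.differentiableAt_cuspFunction_zero hh hgper hhol
      hzero.boundedAtFilter
    rw [eventually_nhdsWithin_iff] at h1
    filter_upwards [h1] with q hq
    rcases eq_or_ne q 0 with rfl | hne
    · exact h2
    · exact hq hne
  have hQa : AnalyticAt ℂ Q 0 := Complex.analyticAt_iff_eventually_differentiableAt.2 hQd
  have him : ∀ᶠ q in 𝓝[≠] (0 : ℂ), L < (Function.Periodic.invQParam h q).im :=
    (Function.Periodic.invQParam_tendsto hh).eventually (hI L)
  have hval : ∀ q : ℂ, q ≠ 0 → L < (Function.Periodic.invQParam h q).im →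
      Q q = (φ (-Complex.I * Function.Periodic.invQParam h q))⁻¹ := by
    intro q hq hlt
    rw [hQ, Function.Periodic.cuspFunction_eq_of_nonzero h g hq]
    simp only [hg, if_pos hlt]
  rcases hQa.eventually_constant_or_nhds_le_map_nhds with hconst | hopen
  · rw [hQ0] at hconst
    obtain ⟨q, ⟨hq1, hq2⟩, hq3⟩ := ((him.and (hconst.filter_mono nhdsWithin_le_nhds)).and
      self_mem_nhdsWithin).exists
    rw [hval q hq3 hq1] at hq2
    exact hφ0 _ ((hmem _).1 hq1) (inv_eq_zero.1 hq2)
  · rw [hQ0] at hopen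
    have hV : {q : ℂ | q ≠ 0 → L < (Function.Periodic.invQParam h q).im} ∈ 𝓝 (0 : ℂ) := by
      rw [eventually_nhdsWithin_iff] at him
      exact him
    have hev : ∀ᶠ y in 𝓝 (0 : ℂ), y ∈ Q '' {q : ℂ | q ≠ 0 → L < (Function.Periodic.invQParam h q).im} :=
      hopen (image_mem_map hV)
    have hcob := tendsto_inv₀_cobounded.eventually hev
    obtain ⟨u, ⟨hu1, hu2⟩, hu3⟩ := ((hc.frequently_le.and_eventually hcob).and_eventually
      (Bornology.eventually_ne_cobounded (0 : ℂ))).exists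
    obtain ⟨q, hq, hqu⟩ := hu2
    have hq0 : q ≠ 0 := by
      rintro rfl
      rw [hQ0] at hqu
      exact hu3 (inv_eq_zero.1 hqu.symm)
    have hw := (hmem _).1 (hq hq0)
    rw [hval q hq0 (hq hq0)] at hqu
    rw [← inv_inj.1 hqu, hfφ _ hw] at hu1
    exact hu1.not_gt ((lt_norm_exp_iff hc.pos _).2 hw)

theorem injOn_lift (hc : IsExteriorCovering f r₀) {φ : ℂ → ℂ}
    (hφ : DifferentiableOn ℂ φ (logHalfPlane r₀))
    (hfφ : ∀ w ∈ logHalfPlane r₀, f (φ w) = Complex.exp w) : InjOn φ (logHalfPlane r₀) := by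
  have key : ∀ w ∈ logHalfPlane r₀, ∀ n : ℕ, 0 < n →
      φ (w - ((n * (2 * Real.pi) : ℝ) : ℂ) * Complex.I) ≠ φ w := by
    intro w hw n hn h
    refine not_periodic_lift hc hφ hfφ (h := n * (2 * Real.pi)) (by positivity) ?_
    have := eqOn_translate hc hφ hfφ (τ := -(((n * (2 * Real.pi) : ℝ) : ℂ) * Complex.I)) (by simp) ?_ hw
      (by rw [← sub_eq_add_neg]; exact h)
    · simpa only [← sub_eq_add_neg] using this
    · rw [Complex.exp_neg, inv_eq_one, Complex.exp_eq_one_iff]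
      exact ⟨n, by push_cast; ring⟩
  intro w₁ h₁ w₂ h₂ h
  have he : Complex.exp w₁ = Complex.exp w₂ := by rw [← hfφ w₁ h₁, ← hfφ w₂ h₂, h]
  obtain ⟨n, hn⟩ := Complex.exp_eq_exp_iff_exists_int.1 he
  rcases lt_trichotomy n 0 with hn0 | rfl | hn0
  · obtain ⟨m, rfl⟩ := Int.exists_eq_neg_ofNat hn0.le
    refine absurd ?_ (key w₂ h₂ m (by omega))
    rw [← h, hn]; congr 1; push_cast; ring
  · simpa using hn
  · obtain ⟨m, rfl⟩ := Int.eq_ofNat_of_zero_le hn0.le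
    refine absurd ?_ (key w₁ h₁ m (by omega))
    rw [h, hn]; congr 1; push_cast; ring

theorem exists_lift (hc : IsExteriorCovering f r₀) {z w₀ : ℂ} (hw₀ : w₀ ∈ logHalfPlane r₀)
    (hz : f z = Complex.exp w₀) :
    ∃ φ : ℂ → ℂ, DifferentiableOn ℂ φ (logHalfPlane r₀) ∧ InjOn φ (logHalfPlane r₀) ∧ φ w₀ = z ∧
      ∀ w ∈ logHalfPlane r₀, f (φ w) = Complex.exp w := by
  obtain ⟨φ, h1, h2, h3⟩ := exists_holomorphic_lift hc.differentiable hc.deriv_ne_zero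
    hc.norm_le_of_asymptotic (isOpen_logHalfPlane r₀) (convex_logHalfPlane r₀)
    Complex.differentiable_exp (fun w hw => (lt_norm_exp_iff hc.pos w).2 hw) hw₀ hz
  exact ⟨φ, h1, injOn_lift hc h1 h3, h2, h3⟩

/-- Univalent inverse branches of the iterates, in logarithmic coordinates for the value. -/
theorem exists_inverse_branch_iterate (hc : IsExteriorCovering f r₀) (n : ℕ) {z w₀ : ℂ}
    (hw₀ : w₀ ∈ logHalfPlane r₀) (hz : f^[n + 1] z = Complex.exp w₀) :
    ∃ ψ : ℂ → ℂ, DifferentiableOn ℂ ψ (logHalfPlane r₀) ∧ InjOn ψ (logHalfPlane r₀) ∧ ψ w₀ = z ∧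
      ∀ w ∈ logHalfPlane r₀, f^[n + 1] (ψ w) = Complex.exp w ∧
        ∀ k < n + 1, r₀ < ‖f^[k + 1] (ψ w)‖ := by
  induction n generalizing w₀ with
  | zero =>
    obtain ⟨φ, h1, h2, h3, h4⟩ := exists_lift hc hw₀ hz
    refine ⟨φ, h1, h2, h3, fun w hw => ⟨h4 w hw, fun k hk => ?_⟩⟩
    obtain rfl : k = 0 := by omega
    simp only [zero_add, Function.iterate_one]
    rw [h4 w hw]; exact (lt_norm_exp_iff hc.pos w).2 hw
  | succ n ih =>
    rw [Function.iterate_succ_apply'] at hz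
    obtain ⟨φ, h1, h2, h3, h4⟩ := exists_lift hc hw₀ hz
    have hφr : ∀ w ∈ logHalfPlane r₀, r₀ < ‖φ w‖ := fun w hw => hc.lt_norm _ (by
      rw [h4 w hw]; exact (lt_norm_exp_iff hc.pos w).2 hw)
    obtain ⟨ℓ, hℓd, hℓ⟩ := exists_differentiableOn_exp_eq (convex_logHalfPlane r₀)
      (isOpen_logHalfPlane r₀) ⟨w₀, hw₀⟩ h1 fun w hw h0 => by
        have := hφr w hw
        rw [h0, norm_zero] at this
        linarith [hc.pos]
    have hmaps : MapsTo ℓ (logHalfPlane r₀) (logHalfPlane r₀) := fun w hw => by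
      rw [← lt_norm_exp_iff hc.pos, hℓ w hw]; exact hφr w hw
    obtain ⟨ψ, k1, k2, k3, k4⟩ := ih (hmaps hw₀) (by rw [hℓ w₀ hw₀, h3])
    refine ⟨ψ ∘ ℓ, k1.comp hℓd hmaps, ?_, k3, fun w hw => ?_⟩
    · refine k2.comp (fun w hw w' hw' h => h2 hw hw' ?_) hmaps
      rw [← hℓ w hw, ← hℓ w' hw', h]
    · have hlast : f^[n + 1 + 1] ((ψ ∘ ℓ) w) = Complex.exp w := by
        rw [Function.iterate_succ_apply', Function.comp_apply, (k4 _ (hmaps hw)).1, hℓ w hw, h4 w hw]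
      refine ⟨hlast, fun k hk => ?_⟩
      rcases Nat.lt_succ_iff_lt_or_eq.1 hk with h | rfl
      · exact (k4 _ (hmaps hw)).2 k h
      · rw [hlast]; exact (lt_norm_exp_iff hc.pos w).2 hw

theorem deriv_ne_zero_of_iterate_eq_exp (hf : Differentiable ℂ f) {n : ℕ} {ψ : ℂ → ℂ}
    (hψ : DifferentiableOn ℂ ψ (logHalfPlane r₀))
    (h : ∀ w ∈ logHalfPlane r₀, f^[n] (ψ w) = Complex.exp w) {w : ℂ} (hw : w ∈ logHalfPlane r₀) :
    deriv ψ w ≠ 0 := by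
  intro h0
  have hnh := (isOpen_logHalfPlane r₀).mem_nhds hw
  have h1 := (hψ.differentiableAt hnh).hasDerivAt
  rw [h0] at h1
  have h2 : HasDerivAt (f^[n]) (deriv (f^[n]) (ψ w)) (ψ w) :=
    ((hf.iterate n) _).hasDerivAt
  have h3 := h2.comp w h1
  have h4 : f^[n] ∘ ψ =ᶠ[𝓝 w] Complex.exp := by
    filter_upwards [hnh] with x hx using h x hx
  have h5 := h3.unique ((Complex.hasDerivAt_exp w).congr_of_eventuallyEq h4)
  rw [mul_zero] at h5
  exact Complex.exp_ne_zero w h5.symm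

/-! ### The complement of `W` in discs -/

/-- The length in the definition of `θ` can be measured on any interval of length `2π`. -/
theorem theta_exp_eq (hf : Continuous f) (r₀ s a : ℝ) :
    ENNReal.ofReal (theta f r₀ (Real.exp s)) =
      volume {t : ℝ | t ∈ Ioc a (a + 2 * Real.pi) ∧ ‖f (Complex.exp (s + t * Complex.I))‖ < r₀} := by
  set A : Set ℝ := {t : ℝ | ‖f (Complex.exp (s + t * Complex.I))‖ < r₀} with hA
  have hpi : (0 : ℝ) < 2 * Real.pi := by positivity
  have hAm : MeasurableSet A := by
    refine (isOpen_lt ?_ continuous_const).measurableSet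
    fun_prop
  have hinv : ∀ g : AddSubgroup.zmultiples (2 * Real.pi), (fun x => g +ᵥ x) ⁻¹' A = A := by
    rintro ⟨g, n, rfl⟩
    ext t
    simp only [mem_preimage, hA, mem_ofPred_eq]
    have : Complex.exp (s + (((⟨n • (2 * Real.pi), ⟨n, rfl⟩⟩ : AddSubgroup.zmultiples (2 * Real.pi)) +ᵥ t : ℝ) : ℂ) * Complex.I)
        = Complex.exp (s + t * Complex.I) := by
      rw [Complex.exp_eq_exp_iff_exists_int]
      refine ⟨n, ?_⟩
      rw [AddSubgroup.vadd_def]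
      simp
      ring
    exact iff_of_eq (by rw [← this])
  have h1 := (isAddFundamentalDomain_Ioc hpi a).measure_set_eq (isAddFundamentalDomain_Ioc hpi 0)
    (μ := volume) hAm hinv
  have h2 : {t : ℝ | t ∈ Ioc a (a + 2 * Real.pi) ∧ ‖f (Complex.exp (s + t * Complex.I))‖ < r₀}
      = A ∩ Ioc a (a + 2 * Real.pi) := by
    ext t; simp [hA, and_comm]
  have h3 : {t : ℝ | t ∈ Icc 0 (2 * Real.pi) ∧
      ‖f ((Real.exp s : ℝ) * Complex.exp (t * Complex.I))‖ < r₀} = A ∩ Icc 0 (2 * Real.pi) := by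
    ext t
    simp [hA, and_comm, Complex.exp_add]
  have hfin : volume (A ∩ Icc 0 (2 * Real.pi)) ≠ ⊤ :=
    ((measure_mono inter_subset_right).trans_lt measure_Icc_lt_top).ne
  rw [h2, h1, theta, h3, ofReal_measureReal hfin, zero_add]
  exact measure_congr ((ae_eq_refl A).inter Ioc_ae_eq_Icc.symm)

theorem ofReal_le_volume_rectangle (hf : Continuous f) {x a m : ℝ}
    (hm : ∀ s ∈ Icc (x - 1) x, m ≤ theta f r₀ (Real.exp s)) :
    ENNReal.ofReal m ≤ volume {w : ℂ | w.re ∈ Icc (x - 1) x ∧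
      w.im ∈ Ioc a (a + 2 * Real.pi) ∧ ‖f (Complex.exp w)‖ < r₀} := by
  set S : Set (ℝ × ℝ) := {p | p.1 ∈ Icc (x - 1) x ∧ p.2 ∈ Ioc a (a + 2 * Real.pi) ∧
    ‖f (Complex.exp (p.1 + p.2 * Complex.I))‖ < r₀} with hS
  have hSm : MeasurableSet S := by
    have h : IsOpen {p : ℝ × ℝ | ‖f (Complex.exp (p.1 + p.2 * Complex.I))‖ < r₀} :=
      isOpen_lt (by fun_prop) continuous_const
    exact (measurable_fst measurableSet_Icc).inter
      ((measurable_snd measurableSet_Ioc).inter h.measurableSet)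
  have h1 : {w : ℂ | w.re ∈ Icc (x - 1) x ∧ w.im ∈ Ioc a (a + 2 * Real.pi) ∧
      ‖f (Complex.exp w)‖ < r₀} = Complex.measurableEquivRealProd ⁻¹' S := by
    ext w
    simp [hS, Complex.measurableEquivRealProd_apply, Complex.re_add_im]
  rw [h1, Complex.volume_preserving_equiv_real_prod.measure_preimage hSm.nullMeasurableSet,
    Measure.volume_eq_prod, Measure.prod_apply hSm]
  calc ENNReal.ofReal m = ∫⁻ _ in Icc (x - 1) x, ENNReal.ofReal m := by simp
    _ ≤ ∫⁻ s in Icc (x - 1) x, volume (Prod.mk s ⁻¹' S) := by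
        refine setLIntegral_mono' measurableSet_Icc fun s hs => ?_
        refine (ENNReal.ofReal_le_ofReal (hm s hs)).trans ?_
        rw [theta_exp_eq hf r₀ s a]
        refine measure_mono fun t ht => ?_
        exact ⟨hs, ht.1, ht.2⟩
    _ ≤ ∫⁻ s, volume (Prod.mk s ⁻¹' S) := setLIntegral_le_lintegral _ _

/-- The complement of `W` in discs about `ζ` that are compactly contained, uniformly, in the half plane
`{Re w > log r₀}`. For large `Re ζ` a disc of radius `10` contains a rectangle of height `2π` to the
left of `ζ`, and `θ` gives the area. For the other `ζ`, where `θ` need not be at least `θ₀`, a large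
disc reaches the half plane `{Re w < R₁}`, which does not meet `W`. -/
theorem exists_ball_diff_logTracts (hf : Continuous f) {R₁ : ℝ} (hR₁ : Real.log r₀ < R₁)
    (hW : logTracts f r₀ ⊆ {z : ℂ | R₁ < z.re}) {θ₀ : ℝ → ℝ} (hanti : AntitoneOn θ₀ (Ioi 0))
    (hpos : ∀ r > 0, 0 < θ₀ r) (hθ : ∀ᶠ r : ℝ in atTop, θ₀ r ≤ theta f r₀ r) :
    ∃ κ ∈ Ioo (0 : ℝ) 1, ∃ c > 0, ∀ ζ : ℂ, R₁ ≤ ζ.re → ∃ ρ > 0, ρ ≤ κ * (ζ.re - Real.log r₀) ∧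
      ENNReal.ofReal (c * θ₀ (Real.exp ζ.re) * ρ ^ 2) ≤ volume (ball ζ ρ \ logTracts f r₀) := by
  obtain ⟨r', hr'⟩ := eventually_atTop.1 hθ
  set L := Real.log r₀ with hL
  set X := max (L + 20) (Real.log (max r' 1) + 1) with hX
  -- For `Re ζ ≤ X` the disc of radius `κ (Re ζ - L)` about `ζ` contains a disc of radius `η` in
  -- `{Re w < R₁}`; for `Re ζ > X` the disc of radius `10` is small enough, and `θ₀ ≤ θ` holds there.
  set η := (R₁ - L) / 4 with hη
  have hη0 : 0 < η := by rw [hη]; linarith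
  have hD : 20 ≤ X - L := by linarith [le_max_left (L + 20) (Real.log (max r' 1) + 1)]
  set κ := max (1 / 2) (1 - 2 * η / (X - L)) with hκ
  have hκ1 : κ < 1 := max_lt (by norm_num) (by
    have : 0 < 2 * η / (X - L) := by positivity
    linarith)
  have hκ0 : 1 / 2 ≤ κ := le_max_left _ _
  have hκη : 1 - κ ≤ 2 * η / (X - L) := by linarith [le_max_right (1 / 2) (1 - 2 * η / (X - L))]
  set m := θ₀ (Real.exp R₁) with hm
  have hm0 : 0 < m := hpos _ (Real.exp_pos _)
  set c := min (1 / 100) (Real.pi * η ^ 2 / (m * (X - L) ^ 2)) with hc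
  have hc0 : 0 < c := by
    refine lt_min (by norm_num) ?_
    have := Real.pi_pos
    have : 0 < X - L := by linarith
    positivity
  refine ⟨κ, ⟨by linarith, hκ1⟩, c, hc0, fun ζ hζ => ?_⟩
  have hθx := hpos (Real.exp ζ.re) (Real.exp_pos _)
  rcases le_or_gt ζ.re X with hle | hgt
  · set d := ζ.re - L with hd
    have hd0 : 0 < d := by rw [hd]; linarith
    have hdX : d ≤ X - L := by rw [hd]; linarith
    refine ⟨κ * d, by positivity, le_rfl, ?_⟩
    set p : ℂ := ⟨R₁ - η, ζ.im⟩ with hp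
    have hkd : (1 - κ) * d ≤ 2 * η := by
      calc (1 - κ) * d ≤ 2 * η / (X - L) * (X - L) := by
            gcongr
        _ = 2 * η := by
            have : X - L ≠ 0 := by linarith
            field_simp
    have hsub : ball p η ⊆ ball ζ (κ * d) \ logTracts f r₀ := by
      intro w hw
      refine ⟨?_, fun hwW => ?_⟩
      · have h1 : dist p ζ = ζ.re - R₁ + η := by
          rw [Complex.dist_of_im_eq (by simp [hp]), hp, Real.dist_eq, abs_of_nonpos (by simp; linarith)]
          simp only; ring
        refine ball_subset_ball' ?_ hw
        rw [h1]
        have : R₁ = L + 4 * η := by rw [hη]; ring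
        nlinarith
      · have h1 : R₁ < w.re := hW hwW
        have h2 : |(w - p).re| < η := (Complex.abs_re_le_norm _).trans_lt (by rwa [mem_ball, dist_eq_norm] at hw)
        rw [abs_lt] at h2
        simp only [Complex.sub_re, hp] at h2
        linarith [h2.2]
    refine le_trans ?_ (measure_mono hsub)
    rw [Complex.volume_ball, ← ENNReal.ofReal_coe_nnreal, ← ENNReal.ofReal_pow hη0.le,
      ← ENNReal.ofReal_mul (by positivity)]
    apply ENNReal.ofReal_le_ofReal
    have hpi : ((NNReal.pi : NNReal) : ℝ) = Real.pi := rfl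
    rw [hpi]
    have hθm : θ₀ (Real.exp ζ.re) ≤ m :=
      hanti (Real.exp_pos _) (Real.exp_pos _) (Real.exp_le_exp.2 hζ)
    have hkd2 : κ * d ≤ X - L := by nlinarith
    calc c * θ₀ (Real.exp ζ.re) * (κ * d) ^ 2
        ≤ (Real.pi * η ^ 2 / (m * (X - L) ^ 2)) * m * (X - L) ^ 2 := by
          gcongr
          exact min_le_right _ _
      _ = η ^ 2 * Real.pi := by
          have : X - L ≠ 0 := by linarith
          field_simp
  · have hd : 20 ≤ ζ.re - L := by linarith
    refine ⟨10, by norm_num, by nlinarith, ?_⟩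
    have hrect := ofReal_le_volume_rectangle (f := f) (r₀ := r₀) hf (x := ζ.re) (a := ζ.im - 4)
      (m := θ₀ (Real.exp ζ.re)) (by
        intro s hs
        have h1 : r' ≤ Real.exp s := by
          have h2 : Real.log (max r' 1) ≤ s := by
            linarith [hs.1, le_max_right (L + 20) (Real.log (max r' 1) + 1)]
          rw [Real.log_le_iff_le_exp (by positivity)] at h2
          exact (le_max_left _ _).trans h2
        exact (hanti (Real.exp_pos _) (Real.exp_pos _) (Real.exp_le_exp.2 hs.2)).trans (hr' _ h1))
    refine le_trans ?_ (hrect.trans (measure_mono ?_))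
    · apply ENNReal.ofReal_le_ofReal
      have : c ≤ 1 / 100 := min_le_left _ _
      nlinarith
    · rintro w ⟨h1, h2, h3⟩
      refine ⟨?_, fun hw => ?_⟩
      · rw [mem_ball, dist_eq_norm]
        refine (Complex.norm_le_abs_re_add_abs_im _).trans_lt ?_
        have ha : |(w - ζ).re| ≤ 1 := by
          rw [Complex.sub_re, abs_le]; constructor <;> linarith [h1.1, h1.2]
        have hb : |(w - ζ).im| ≤ 4 := by
          rw [Complex.sub_im, abs_le]
          constructor <;> linarith [h2.1, h2.2, Real.pi_lt_d2]
        linarith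
      · have : r₀ < ‖f (Complex.exp w)‖ := hw
        linarith

/-! ### Growth of the iterates -/

theorem norm_le_maxModulus (hf : Continuous f) (z : ℂ) : ‖f z‖ ≤ maxModulus f ‖z‖ :=
  le_csSup ((isCompact_sphere (0 : ℂ) ‖z‖).image hf.norm).bddAbove
    ⟨z, by simp, rfl⟩

/-- Finite order, as a bound valid in the whole plane. -/
theorem exists_log_norm_le (hf : Continuous f) (hord : order f < ⊤) :
    ∃ ρ ≥ 1, ∃ C ≥ 0, ∀ z : ℂ,
      Real.log (1 + ‖f z‖) ≤ Real.exp (ρ * Real.log (1 + ‖z‖) + C) := by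
  obtain ⟨ρ', hρ', -⟩ := EReal.lt_iff_exists_real_btwn.1 hord
  have hev := eventually_lt_of_limsup_lt hρ'
  obtain ⟨r₁, hr₁⟩ := eventually_atTop.1 (hev.and (eventually_gt_atTop 1))
  obtain ⟨M, hM⟩ := (isCompact_closedBall (0 : ℂ) r₁).exists_bound_of_continuousOn hf.continuousOn
  refine ⟨max ρ' 1, le_max_right _ _, max 1 M, zero_le_one.trans (le_max_left _ _), fun z => ?_⟩
  have hz0 := norm_nonneg z
  have hf0 := norm_nonneg (f z)
  have hlz : 0 ≤ Real.log (1 + ‖z‖) := Real.log_nonneg (by linarith)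
  set a := max ρ' 1 * Real.log (1 + ‖z‖) with ha
  have ha0 : 0 ≤ a := mul_nonneg (zero_le_one.trans (le_max_right _ _)) hlz
  rcases le_or_gt ‖z‖ r₁ with hle | hgt
  · have h1 := hM z (mem_closedBall_zero_iff.2 hle)
    calc Real.log (1 + ‖f z‖) ≤ ‖f z‖ := by
          have := Real.log_le_sub_one_of_pos (show 0 < 1 + ‖f z‖ by linarith)
          linarith
      _ ≤ M := h1
      _ ≤ a + max 1 M := by linarith [le_max_right 1 M]
      _ ≤ Real.exp (a + max 1 M) := by linarith [Real.add_one_le_exp (a + max 1 M)]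
  · obtain ⟨h1, h2⟩ := hr₁ ‖z‖ hgt.le
    have hlog : 0 < Real.log ‖z‖ := Real.log_pos h2
    have h3 : Real.log (Real.log (maxModulus f ‖z‖)) / Real.log ‖z‖ < ρ' := by exact_mod_cast h1
    rw [div_lt_iff₀ hlog] at h3
    have h4 : Real.log (Real.log (maxModulus f ‖z‖)) ≤ a := by
      refine h3.le.trans ?_
      rw [ha]
      have : Real.log ‖z‖ ≤ Real.log (1 + ‖z‖) := Real.log_le_log (by linarith) (by linarith)
      calc ρ' * Real.log ‖z‖ ≤ max ρ' 1 * Real.log ‖z‖ := by gcongr; exact le_max_left _ _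
        _ ≤ _ := by gcongr
    -- The bounds below also hold where a logarithm of a nonpositive number occurs.
    have h5 : Real.log (maxModulus f ‖z‖) ≤ Real.exp a := by
      rcases le_or_gt (Real.log (maxModulus f ‖z‖)) 0 with h | h
      · exact h.trans (Real.exp_pos _).le
      · exact (Real.log_le_iff_le_exp h).1 h4
    have h6 : ‖f z‖ ≤ Real.exp (Real.exp a) := by
      refine (norm_le_maxModulus hf z).trans ?_
      rcases le_or_gt (maxModulus f ‖z‖) 0 with h | h
      · exact h.trans (Real.exp_pos _).le
      · exact (Real.log_le_iff_le_exp h).1 h5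
    have h7 : 1 + ‖f z‖ ≤ Real.exp (1 + Real.exp a) := by
      rw [Real.exp_add]
      have := Real.one_le_exp (Real.exp_pos a).le
      have := Real.add_one_le_exp 1
      nlinarith
    calc Real.log (1 + ‖f z‖) ≤ 1 + Real.exp a := (Real.log_le_iff_le_exp (by linarith)).2 h7
      _ ≤ Real.exp a * Real.exp 1 := by
        have := Real.one_le_exp ha0
        have := Real.add_one_le_exp 1
        nlinarith
      _ = Real.exp (a + 1) := (Real.exp_add _ _).symm
      _ ≤ _ := Real.exp_le_exp.2 (by linarith [le_max_left 1 M])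

theorem natCast_le_iterate_exp (m : ℕ) : (m : ℝ) ≤ Real.exp^[m] 0 := by
  induction m with
  | zero => simp
  | succ m ih =>
    rw [Function.iterate_succ_apply']
    push_cast
    linarith [Real.add_one_le_exp (Real.exp^[m] 0)]

/-- With `u = ρ log (1 + ‖z‖) + t` and `t` large, the bound on `f` becomes `u(f(z)) ≤ e^{u(z)}`. -/
theorem exists_norm_iterate_le (hf : Continuous f) (hord : order f < ⊤) (R : ℝ) :
    ∃ m : ℕ, ∀ (n : ℕ) (z : ℂ), ‖z‖ ≤ R → ‖f^[n] z‖ ≤ Real.exp^[n + m] 0 := by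
  obtain ⟨ρ, hρ, C, hC, hb⟩ := exists_log_norm_le hf hord
  set t := 2 * (ρ * Real.exp C) with ht
  have heC : 1 ≤ Real.exp C := Real.one_le_exp hC
  have ht2 : 1 ≤ ρ * Real.exp C := by nlinarith
  have htexp : ρ * Real.exp C + t ≤ Real.exp t := by
    have := Real.quadratic_le_exp_of_nonneg (x := t) (by linarith)
    nlinarith
  set u : ℂ → ℝ := fun z => ρ * Real.log (1 + ‖z‖) + t with hu
  have hlog0 : ∀ z : ℂ, 0 ≤ Real.log (1 + ‖z‖) := fun z =>
    Real.log_nonneg (by linarith [norm_nonneg z])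
  have hstep : ∀ z, u (f z) ≤ Real.exp (u z) := by
    intro z
    set a := ρ * Real.log (1 + ‖z‖) with ha
    have ha0 : 0 ≤ a := mul_nonneg (by linarith) (hlog0 z)
    have h1 := Real.one_le_exp ha0
    calc u (f z) ≤ ρ * Real.exp (a + C) + t := by
          simp only [hu]; gcongr; exact hb z
      _ ≤ Real.exp a * (ρ * Real.exp C + t) := by
          rw [Real.exp_add]
          nlinarith
      _ ≤ Real.exp a * Real.exp t := by gcongr
      _ = Real.exp (u z) := by rw [← Real.exp_add]
  have hiter : ∀ (n : ℕ) (z : ℂ), u (f^[n] z) ≤ Real.exp^[n] (u z) := by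
    intro n z
    induction n with
    | zero => simp
    | succ n ih =>
      rw [Function.iterate_succ_apply', Function.iterate_succ_apply']
      exact (hstep _).trans (Real.exp_le_exp.2 ih)
  obtain ⟨m, hm⟩ := exists_nat_ge (ρ * Real.log (1 + max R 0) + t)
  refine ⟨m + 1, fun n z hz => ?_⟩
  have huz : u z ≤ Real.exp^[m] 0 := by
    refine le_trans ?_ (hm.trans (natCast_le_iterate_exp m))
    simp only [hu]
    have : Real.log (1 + ‖z‖) ≤ Real.log (1 + max R 0) :=
      Real.log_le_log (by linarith [norm_nonneg z]) (by linarith [le_max_left R 0])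
    gcongr
  have h1 : u (f^[n] z) ≤ Real.exp^[n + m] 0 := by
    rw [Function.iterate_add_apply]
    exact (hiter n z).trans (Real.exp_strictMono.monotone.iterate n huz)
  rw [← add_assoc, Function.iterate_succ_apply']
  have h2 : Real.log (1 + ‖f^[n] z‖) ≤ u (f^[n] z) := by
    simp only [hu]
    nlinarith [hlog0 (f^[n] z)]
  have h3 := (Real.log_le_iff_le_exp (by linarith [norm_nonneg (f^[n] z)])).1 (h2.trans h1)
  linarith

/-! ### Orbits of points of the Julia set -/

theorem mapsTo_iterate_ball {r₁ : ℝ} (hr : r₀ < r₁) (hfr : ∀ z, ‖z‖ ≤ r₁ → ‖f z‖ ≤ r₀) (n : ℕ) :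
    MapsTo f^[n] (ball 0 r₁) (ball 0 r₁) := by
  refine MapsTo.iterate (fun z hz => ?_) n
  rw [mem_ball_zero_iff] at hz ⊢
  exact (hfr z hz.le).trans_lt hr

/-- The iterates are equi-Lipschitz on the smaller disc, by Cauchy's estimate. -/
theorem norm_iterate_sub_le {r₁ : ℝ} (hf : Differentiable ℂ f) (hr : r₀ < r₁)
    (hfr : ∀ z, ‖z‖ ≤ r₁ → ‖f z‖ ≤ r₀) (n : ℕ) {x y : ℂ} (hx : x ∈ closedBall (0 : ℂ) r₀)
    (hy : y ∈ closedBall (0 : ℂ) r₀) :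
    ‖f^[n] x - f^[n] y‖ ≤ r₁ / ((r₁ - r₀) / 2) * ‖x - y‖ := by
  have hd : Differentiable ℂ f^[n] := hf.iterate n
  refine (convex_closedBall (0 : ℂ) r₀).norm_image_sub_le_of_norm_deriv_le
    (fun z _ => hd z) (fun z hz => ?_) hy hx
  refine Complex.norm_deriv_le_of_forall_mem_sphere_norm_le (by linarith) hd.diffContOnCl
    fun w hw => ?_
  have hw' : w ∈ ball (0 : ℂ) r₁ := by
    rw [mem_ball_zero_iff]
    rw [mem_closedBall_zero_iff] at hz
    rw [mem_sphere, dist_eq_norm] at hw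
    have := norm_add_le (w - z) z
    rw [sub_add_cancel] at this
    linarith
  exact (mem_ball_zero_iff.1 (mapsTo_iterate_ball hr hfr n hw')).le

/-- The Arzelà-Ascoli theorem for the iterates. -/
theorem exists_subseq_tendstoUniformlyOn_iterate {r₁ : ℝ} (hf : Differentiable ℂ f)
    (hr₀ : 0 ≤ r₀) (hr : r₀ < r₁) (hfr : ∀ z, ‖z‖ ≤ r₁ → ‖f z‖ ≤ r₀) (n : ℕ → ℕ) :
    ∃ (φ : ℕ → ℕ) (G : ℂ → ℂ), StrictMono φ ∧
      TendstoUniformlyOn (fun k => f^[n (φ k)]) G atTop (closedBall 0 r₀) := by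
  classical
  set K : Set ℂ := closedBall 0 r₀ with hK
  have : CompactSpace K := isCompact_iff_compactSpace.1 (isCompact_closedBall _ _)
  have hKr : K ⊆ ball 0 r₁ := closedBall_subset_ball hr
  let F : ℕ → BoundedContinuousFunction K ℂ := fun j =>
    BoundedContinuousFunction.mkOfCompact
      ⟨fun x => f^[j] x, (hf.iterate j).continuous.comp continuous_subtype_val⟩
  have hcomp : IsCompact (closure (range F)) := by
    refine BoundedContinuousFunction.arzela_ascoli (closedBall (0 : ℂ) r₁)
      (isCompact_closedBall _ _) (range F) ?_ ?_
    · rintro _ x ⟨j, rfl⟩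
      exact ball_subset_closedBall (mapsTo_iterate_ball hr hfr j (hKr x.2))
    · set L := r₁ / ((r₁ - r₀) / 2) with hL
      have hL0 : 0 ≤ L := div_nonneg (by linarith) (by linarith)
      refine Metric.equicontinuous_of_continuity_modulus (fun s => L * s) ?_ _ ?_
      · have : Continuous fun s : ℝ => L * s := by fun_prop
        simpa using this.tendsto 0
      · rintro x y ⟨_, j, rfl⟩
        rw [dist_eq_norm, Subtype.dist_eq, dist_eq_norm]
        exact norm_iterate_sub_le hf hr hfr j x.2 y.2
  obtain ⟨G, -, φ, hφ, hG⟩ := hcomp.tendsto_subseq (x := fun k => F (n k))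
    fun k => subset_closure (mem_range_self _)
  rw [BoundedContinuousFunction.tendsto_iff_tendstoUniformly] at hG
  refine ⟨φ, fun z => if hz : z ∈ K then G ⟨z, hz⟩ else 0, hφ, ?_⟩
  rw [Metric.tendstoUniformlyOn_iff]
  rw [Metric.tendstoUniformly_iff] at hG
  intro ε hε
  filter_upwards [hG ε hε] with k hk z hz
  have := hk ⟨z, hz⟩
  simp only [dif_pos hz]
  exact this

theorem norm_iterate_ge_of_mem_juliaSet {r₁ : ℝ} (hf : Differentiable ℂ f)
    (hr₀ : 0 ≤ r₀) (hr : r₀ < r₁) (hfr : ∀ z, ‖z‖ ≤ r₁ → ‖f z‖ ≤ r₀) {z : ℂ}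
    (hz : z ∈ juliaSet f) (N : ℕ) : r₁ ≤ ‖f^[N] z‖ := by
  by_contra! hlt
  refine hz ?_
  have hev : ∀ᶠ y in 𝓝 z, ‖f^[N] y‖ < r₁ :=
    ((hf.iterate N).continuous.norm.tendsto z).eventually_lt_const hlt
  obtain ⟨ε, hε, hball⟩ := Metric.eventually_nhds_iff_ball.1 hev
  refine ⟨ε, hε, fun g hg => ?_⟩
  choose n hn using hg
  replace hn : ∀ k, g k = f^[n k] := fun k => (hn k).symm
  -- `f^[N + 1]` maps the disc about `z` into the disc where subsequences of the iterates converge.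
  by_cases hfreq : ∃ᶠ k in atTop, N + 1 ≤ n k
  · obtain ⟨φ₀, hφ₀, hφ₀n⟩ := extraction_of_frequently_atTop hfreq
    obtain ⟨φ₁, G, hφ₁, hG⟩ := exists_subseq_tendstoUniformlyOn_iterate hf hr₀ hr hfr
      (fun k => n (φ₀ k) - (N + 1))
    refine ⟨φ₀ ∘ φ₁, hφ₀.comp hφ₁, Or.inl ⟨fun y => G (f^[N + 1] y), ?_⟩⟩
    refine TendstoUniformlyOn.tendstoLocallyUniformlyOn ?_
    rw [Metric.tendstoUniformlyOn_iff] at hG ⊢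
    intro δ hδ
    filter_upwards [hG δ hδ] with k hk y hy
    have hy' : f^[N + 1] y ∈ closedBall (0 : ℂ) r₀ := by
      rw [mem_closedBall_zero_iff, Function.iterate_succ_apply']
      exact hfr _ (hball y hy).le
    have h1 := hk _ hy'
    rw [← Function.iterate_add_apply, Nat.sub_add_cancel (hφ₀n (φ₁ k))] at h1
    rwa [hn]
  -- Otherwise some iterate occurs infinitely often in the sequence.
  · rw [not_frequently] at hfreq
    obtain ⟨j, -, hj⟩ : ∃ j ∈ Finset.range (N + 1), ∃ᶠ k in atTop, n k = j := by
      by_contra! hcon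
      have h1 : ∀ᶠ k in atTop, ∀ j ∈ Finset.range (N + 1), n k ≠ j :=
        (Filter.eventually_all_finset _).2 hcon
      obtain ⟨k, hk1, hk2⟩ := (hfreq.and h1).exists
      exact hk2 (n k) (Finset.mem_range.2 (not_le.1 hk1)) rfl
    obtain ⟨φ, hφ, hφj⟩ := extraction_of_frequently_atTop hj
    refine ⟨φ, hφ, Or.inl ⟨f^[j], ?_⟩⟩
    refine TendstoUniformlyOn.tendstoLocallyUniformlyOn ?_
    rw [Metric.tendstoUniformlyOn_iff]
    intro δ hδ
    filter_upwards with k y _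
    rw [hn, hφj k, dist_self]
    exact hδ

/-! ### Area estimates and the covering argument -/

theorem ofReal_mul_volume_le_volume_image {g : ℂ → ℂ} {E : Set ℂ} (hE : MeasurableSet E)
    (hg : ∀ z ∈ E, DifferentiableAt ℂ g z) (hinj : InjOn g E) {a : ℝ} (ha : 0 ≤ a)
    (hga : ∀ z ∈ E, a ≤ ‖deriv g z‖) :
    ENNReal.ofReal (a ^ 2) * volume E ≤ volume (g '' E) := by
  have hdet : ∀ b : ℂ, (b • (1 : ℂ →L[ℝ] ℂ)).det = ‖b‖ ^ 2 := by
    intro b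
    have : ((b • (1 : ℂ →L[ℝ] ℂ) : ℂ →L[ℝ] ℂ) : ℂ →ₗ[ℝ] ℂ) =
        (LinearMap.toSpanSingleton ℂ ℂ b).restrictScalars ℝ := by
      ext; simp [mul_comm]
    rw [ContinuousLinearMap.det, this, LinearMap.det_restrictScalars, Algebra.norm_complex_eq]
    simp [Complex.normSq_eq_norm_sq]
  rw [← lintegral_abs_det_fderiv_eq_addHaar_image volume hE
    (f' := fun z => deriv g z • (1 : ℂ →L[ℝ] ℂ))
    (fun z hz => ((hg z hz).hasDerivAt.complexToReal_fderiv).hasFDerivWithinAt) hinj]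
  rw [← setLIntegral_const]
  refine setLIntegral_mono' hE fun z hz => ENNReal.ofReal_le_ofReal ?_
  rw [hdet, abs_of_nonneg (by positivity)]
  exact pow_le_pow_left₀ ha (hga z hz) 2

/-- Vitali covering: if `B` has density at least `δ / π` in some ball about each point of `A`, of
bounded radius and inside `D`, then `B ∩ D` has at least `δ / (16 π)` times the measure of `A`. -/
theorem ofReal_mul_volume_le_of_forall_exists_ball {A B D : Set ℂ} (hB : MeasurableSet B)
    {δ ρ : ℝ}
    (h : ∀ z ∈ A, ∃ r > 0, r ≤ ρ ∧ ball z r ⊆ D ∧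
      ENNReal.ofReal (δ * r ^ 2) ≤ volume (B ∩ ball z r)) :
    ENNReal.ofReal δ * volume A ≤ ENNReal.ofReal (16 * Real.pi) * volume (B ∩ D) := by
  choose! r hr0 hrρ hrD hr using h
  obtain ⟨u, huA, hdisj, hcov⟩ := Vitali.exists_disjoint_subfamily_covering_enlargement_ball A
    (fun z => z) r ρ hrρ 4 (by norm_num)
  have hcount : u.Countable := hdisj.countable_of_isOpen (fun z _ => isOpen_ball)
    fun z hz => nonempty_ball.2 (hr0 z (huA hz))
  have hAsub : A ⊆ ⋃ z ∈ u, ball z (4 * r z) := by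
    intro z hz
    obtain ⟨b, hb, hsub⟩ := hcov z hz
    exact mem_biUnion hb (hsub (mem_ball_self (hr0 z hz)))
  have hball : ∀ z ∈ u, ENNReal.ofReal δ * volume (ball z (4 * r z)) ≤
      ENNReal.ofReal (16 * Real.pi) * volume (B ∩ ball z (r z)) := by
    intro z hz
    have hrz := (hr0 z (huA hz)).le
    have hpi : ((NNReal.pi : NNReal) : ℝ) = Real.pi := rfl
    calc ENNReal.ofReal δ * volume (ball z (4 * r z))
        = ENNReal.ofReal (16 * Real.pi) * ENNReal.ofReal (δ * r z ^ 2) := by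
          rw [Complex.volume_ball, ← ENNReal.ofReal_coe_nnreal, ← ENNReal.ofReal_pow (by positivity),
            ← ENNReal.ofReal_mul (by positivity), hpi, ← ENNReal.ofReal_mul' (by positivity),
            ← ENNReal.ofReal_mul (by positivity)]
          congr 1; ring
      _ ≤ _ := by gcongr; exact hr z (huA hz)
  have : Countable u := hcount.to_subtype
  calc ENNReal.ofReal δ * volume A
      ≤ ENNReal.ofReal δ * ∑' z : u, volume (ball (z : ℂ) (4 * r z)) := by
        gcongr
        refine (measure_mono hAsub).trans ?_
        exact measure_biUnion_le volume hcount _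
    _ = ∑' z : u, ENNReal.ofReal δ * volume (ball (z : ℂ) (4 * r z)) := ENNReal.tsum_mul_left.symm
    _ ≤ ∑' z : u, ENNReal.ofReal (16 * Real.pi) * volume (B ∩ ball (z : ℂ) (r z)) :=
        ENNReal.tsum_le_tsum fun z => hball z z.2
    _ = ENNReal.ofReal (16 * Real.pi) * ∑' z : u, volume (B ∩ ball (z : ℂ) (r z)) :=
        ENNReal.tsum_mul_left
    _ = ENNReal.ofReal (16 * Real.pi) * volume (⋃ z ∈ u, B ∩ ball z (r z)) := by
        rw [measure_biUnion hcount (fun x hx y hy hxy =>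
          (hdisj hx hy hxy).mono inter_subset_right inter_subset_right)
          fun z _ => hB.inter measurableSet_ball]
    _ ≤ _ := by
        gcongr
        exact iUnion₂_subset fun z hz => inter_subset_inter_right _ (hrD z (huA hz))

/-- The points whose orbit, from time `1` on, is in the disc of radius `r₀` for the first time at time
`n + 2`. -/
def captureSet (f : ℂ → ℂ) (r₀ : ℝ) (n : ℕ) : Set ℂ :=
  {z | (∀ k < n + 1, r₀ < ‖f^[k + 1] z‖) ∧ ‖f^[n + 2] z‖ ≤ r₀}

theorem measurableSet_captureSet (hf : Continuous f) (r₀ : ℝ) (n : ℕ) :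
    MeasurableSet (captureSet f r₀ n) := by
  have h1 : captureSet f r₀ n = (⋂ k ∈ Iio (n + 1), {z | r₀ < ‖f^[k + 1] z‖}) ∩
      {z | ‖f^[n + 2] z‖ ≤ r₀} := by
    ext z; simp [captureSet]
  rw [h1]
  refine (MeasurableSet.biInter (to_countable _) fun k _ => ?_).inter ?_
  · exact (isOpen_lt continuous_const (hf.iterate _).norm).measurableSet
  · exact (isClosed_le (hf.iterate _).norm continuous_const).measurableSet

theorem pairwise_disjoint_captureSet (f : ℂ → ℂ) (r₀ : ℝ) :
    Pairwise (Function.onFun Disjoint (captureSet f r₀)) := by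
  have key : ∀ m n : ℕ, m < n → Disjoint (captureSet f r₀ m) (captureSet f r₀ n) := by
    intro m n hmn
    rw [Set.disjoint_left]
    intro z hm hn
    exact (hn.1 (m + 1) (by omega)).not_ge hm.2
  intro m n hmn
  rcases hmn.lt_or_gt with h | h
  · exact key m n h
  · exact (key n m h).symm

/-- Around a point whose orbit is outside the disc of radius `e^{R₁}` at time `n + 1`, the captured
set has a definite density in some disc: it is the image, under a branch of bounded distortion, of
the complement of `W` in a disc. As the branch omits `0`, the radius is at most a multiple of `‖z‖`. -/
theorem exists_ball_captureSet (hc : IsExteriorCovering f r₀) {R₁ : ℝ} (hR₁ : Real.log r₀ < R₁)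
    {θ₀ : ℝ → ℝ} {κ c : ℝ} (hκ : κ ∈ Ioo (0 : ℝ) 1) (hc0 : 0 < c)
    (hG : ∀ ζ : ℂ, R₁ ≤ ζ.re → ∃ ρ > 0, ρ ≤ κ * (ζ.re - Real.log r₀) ∧
      ENNReal.ofReal (c * θ₀ (Real.exp ζ.re) * ρ ^ 2) ≤ volume (ball ζ ρ \ logTracts f r₀)) :
    ∃ C > 0, ∃ c' > 0, ∀ (n : ℕ) (z : ℂ), Real.exp R₁ ≤ ‖f^[n + 1] z‖ →
      ∃ r > 0, r ≤ C * ‖z‖ ∧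
        ENNReal.ofReal (c' * θ₀ ‖f^[n + 1] z‖ * r ^ 2) ≤ volume (captureSet f r₀ n ∩ ball z r) := by
  set K := distortionConst κ with hK
  have hK0 : 0 < K := distortionConst_pos hκ.2
  have hpi := Real.pi_pos
  refine ⟨K * (48 * Real.pi), by positivity, c / K ^ 4, by positivity, fun n z hz => ?_⟩
  have hzn : 0 < ‖f^[n + 1] z‖ := (Real.exp_pos _).trans_le hz
  set w₀ := Complex.log (f^[n + 1] z) with hw₀
  have hw₀e : Complex.exp w₀ = f^[n + 1] z := Complex.exp_log (norm_pos_iff.1 hzn)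
  have hw₀re : Real.exp w₀.re = ‖f^[n + 1] z‖ := by rw [← hw₀e, Complex.norm_exp]
  have hw₀R : R₁ ≤ w₀.re := by rw [← Real.exp_le_exp, hw₀re]; exact hz
  set d := w₀.re - Real.log r₀ with hd
  have hd0 : 0 < d := by rw [hd]; linarith
  have hw₀H : w₀ ∈ logHalfPlane r₀ := by
    change Real.log r₀ < w₀.re; linarith
  have hballH : ball w₀ d ⊆ logHalfPlane r₀ := by
    intro w hw
    rw [mem_ball, dist_eq_norm] at hw
    have h1 := (abs_lt.1 ((Complex.abs_re_le_norm (w - w₀)).trans_lt hw)).1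
    rw [Complex.sub_re] at h1
    change Real.log r₀ < w.re
    linarith
  obtain ⟨ψ, hψd, hψi, hψz, hψ⟩ := exists_inverse_branch_iterate hc n hw₀H hw₀e.symm
  have hψ' : ∀ w ∈ logHalfPlane r₀, deriv ψ w ≠ 0 := fun w hw =>
    deriv_ne_zero_of_iterate_eq_exp hc.differentiable hψd (fun w hw => (hψ w hw).1) hw
  have h0 : (0 : ℂ) ∉ ψ '' ball w₀ d := by
    rintro ⟨w, hw, hw0⟩
    have h1 := (hψ w (hballH hw)).2 0 (by omega)
    rw [zero_add, Function.iterate_one] at h1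
    have h2 := hc.lt_norm _ h1
    rw [hw0, norm_zero] at h2
    linarith [hc.pos]
  obtain ⟨ρ, hρ0, hρ, hvol⟩ := hG w₀ hw₀R
  set a := ‖deriv ψ w₀‖ with ha
  have ha0 : 0 < a := norm_pos_iff.2 (hψ' w₀ hw₀H)
  have hρd : ρ ≤ d := hρ.trans (by nlinarith [hκ.2])
  have hκd : κ * d ≤ d := by nlinarith [hκ.2]
  have hρball : ball w₀ ρ ⊆ closedBall w₀ (κ * d) :=
    ball_subset_closedBall.trans (closedBall_subset_closedBall hρ)
  have hρH : ball w₀ ρ ⊆ logHalfPlane r₀ := (ball_subset_ball hρd).trans hballH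
  have hcent : w₀ ∈ closedBall w₀ (κ * d) := mem_closedBall_self (mul_pos hκ.1 hd0).le
  have hdist : ∀ w ∈ ball w₀ ρ, ‖w - w₀‖ ≤ d := fun w hw => by
    rw [mem_ball, dist_eq_norm] at hw; linarith
  have hup : ∀ w ∈ ball w₀ ρ, ‖deriv ψ w‖ ≤ K * a := fun w hw =>
    norm_deriv_le_distortionConst_mul hd0 hκ.2 (hψd.mono hballH) (hψi.mono hballH)
      (fun w hw => hψ' w (hballH hw)) h0 hcent (hρball hw) (hdist w hw)
  have hlow : ∀ w ∈ ball w₀ ρ, a / K ≤ ‖deriv ψ w‖ := fun w hw => by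
    rw [div_le_iff₀' hK0]
    exact norm_deriv_le_distortionConst_mul hd0 hκ.2 (hψd.mono hballH) (hψi.mono hballH)
      (fun w hw => hψ' w (hballH hw)) h0 (hρball hw) hcent
      (by rw [norm_sub_rev]; exact hdist w hw)
  have hdiff : ∀ w ∈ ball w₀ ρ, DifferentiableAt ℂ ψ w := fun w hw =>
    hψd.differentiableAt ((isOpen_logHalfPlane r₀).mem_nhds (hρH hw))
  -- The image of the disc of radius `ρ` about `w₀` lies in the disc of radius `K a ρ` about `z`.
  refine ⟨K * a * ρ, by positivity, ?_, ?_⟩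
  · have h1 := norm_deriv_le_of_injOn_of_notMem_image hd0 (hψd.mono hballH) (hψi.mono hballH) h0
    rw [hψz, sub_zero, ← ha] at h1
    calc K * a * ρ ≤ K * (d * a) := by
          rw [mul_assoc]; gcongr ?_ * ?_
          rw [mul_comm]; gcongr
      _ ≤ K * (48 * Real.pi * ‖z‖) := by gcongr
      _ = _ := by ring
  · have hWo : IsOpen (logTracts f r₀) := by
      refine IsOpen.preimage Complex.continuous_exp (IsOpen.preimage hc.differentiable.continuous ?_)
      exact isOpen_lt continuous_const continuous_norm
    set E := ball w₀ ρ \ logTracts f r₀ with hE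
    have hEm : MeasurableSet E := measurableSet_ball.diff hWo.measurableSet
    have himg : ψ '' E ⊆ captureSet f r₀ n ∩ ball z (K * a * ρ) := by
      rintro _ ⟨w, ⟨hwb, hwW⟩, rfl⟩
      have hwH := hρH hwb
      refine ⟨⟨(hψ w hwH).2, ?_⟩, ?_⟩
      · rw [Function.iterate_succ_apply', (hψ w hwH).1]
        exact not_lt.1 hwW
      · have h1 := (convex_ball w₀ ρ).norm_image_sub_le_of_norm_deriv_le hdiff hup
          (mem_ball_self hρ0) hwb
        rw [hψz] at h1
        rw [mem_ball, dist_eq_norm]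
        rw [mem_ball, dist_eq_norm] at hwb
        refine h1.trans_lt ?_
        gcongr
    refine le_trans ?_ (measure_mono himg)
    refine le_trans ?_ (ofReal_mul_volume_le_volume_image hEm (fun w hw => hdiff w hw.1)
      (hψi.mono fun w hw => hρH hw.1) (by positivity : 0 ≤ a / K) fun w hw => hlow w hw.1)
    rw [hw₀re] at hvol
    refine le_trans ?_ (mul_le_mul_right hvol _)
    rw [← ENNReal.ofReal_mul (by positivity)]
    apply ENNReal.ofReal_le_ofReal
    apply le_of_eq
    field_simp

/-- A decreasing function with divergent sum along a sequence tending to `∞` is positive. -/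
theorem pos_of_tendsto_sum {θ₀ : ℝ → ℝ} (hanti : AntitoneOn θ₀ (Ioi 0))
    (hsum : Tendsto (fun n : ℕ => ∑ k ∈ Finset.Icc 1 n, θ₀ (Real.exp^[k] 0)) atTop atTop) :
    ∀ r > 0, 0 < θ₀ r := by
  intro r hr
  by_contra! hle
  obtain ⟨k₀, hk₀⟩ := exists_nat_ge r
  have hneg : ∀ k, k₀ ≤ k → θ₀ (Real.exp^[k] 0) ≤ 0 := by
    intro k hk
    have h1 : r ≤ Real.exp^[k] 0 :=
      hk₀.trans ((Nat.cast_le.2 hk).trans (natCast_le_iterate_exp k))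
    exact (hanti hr (hr.trans_le h1) h1).trans hle
  have hbound : ∀ n, k₀ ≤ n → ∑ k ∈ Finset.Icc 1 n, θ₀ (Real.exp^[k] 0) ≤
      ∑ k ∈ Finset.Icc 1 k₀, θ₀ (Real.exp^[k] 0) := by
    intro n hn
    induction n, hn using Nat.le_induction with
    | base => exact le_rfl
    | succ n hn ih =>
      rw [Finset.sum_Icc_succ_top (by omega)]
      linarith [hneg (n + 1) (by omega)]
  obtain ⟨n, hn1, hn2⟩ := ((hsum.eventually_gt_atTop
    (∑ k ∈ Finset.Icc 1 k₀, θ₀ (Real.exp^[k] 0))).and (eventually_ge_atTop k₀)).exists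
  exact (hbound n hn2).not_gt hn1

theorem tendsto_sum_iterate_exp_add {θ₀ : ℝ → ℝ}
    (hsum : Tendsto (fun n : ℕ => ∑ k ∈ Finset.Icc 1 n, θ₀ (Real.exp^[k] 0)) atTop atTop)
    (m : ℕ) :
    Tendsto (fun N : ℕ => ∑ n ∈ Finset.range N, θ₀ (Real.exp^[n + 1 + m] 0)) atTop atTop := by
  have h1 : ∀ N, ∑ k ∈ Finset.Icc 1 (N + m), θ₀ (Real.exp^[k] 0) =
      (∑ n ∈ Finset.range N, θ₀ (Real.exp^[n + 1 + m] 0)) +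
        ∑ k ∈ Finset.Icc 1 m, θ₀ (Real.exp^[k] 0) := by
    intro N
    induction N with
    | zero => simp
    | succ N ih =>
      rw [show N + 1 + m = (N + m) + 1 by ring, Finset.sum_Icc_succ_top (by omega), ih,
        Finset.sum_range_succ, show N + m + 1 = N + 1 + m by ring]
      ring
  have h2 := hsum.comp (tendsto_add_atTop_nat m)
  have h3 := tendsto_atTop_add_const_right atTop (-∑ k ∈ Finset.Icc 1 m, θ₀ (Real.exp^[k] 0)) h2
  refine h3.congr fun N => ?_
  simp only [Function.comp_apply, h1]
  ring

theorem norm_le_of_logTracts_subset (hf : Continuous f) {R₁ : ℝ}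
    (hW : logTracts f r₀ ⊆ {z : ℂ | R₁ < z.re}) {z : ℂ} (hz : ‖z‖ ≤ Real.exp R₁) : ‖f z‖ ≤ r₀ := by
  have key : ∀ u : ℂ, u ≠ 0 → ‖u‖ ≤ Real.exp R₁ → ‖f u‖ ≤ r₀ := by
    intro u hu0 hu
    by_contra! hlt
    have h1 : Complex.log u ∈ logTracts f r₀ := by
      change r₀ < ‖f (Complex.exp (Complex.log u))‖
      rwa [Complex.exp_log hu0]
    have h2 : R₁ < (Complex.log u).re := hW h1
    rw [Complex.log_re, Real.lt_log_iff_exp_lt (norm_pos_iff.2 hu0)] at h2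
    linarith
  rcases eq_or_ne z 0 with rfl | h0
  · have h1 : Tendsto (fun u => ‖f u‖) (𝓝[≠] 0) (𝓝 ‖f 0‖) :=
      (hf.norm.tendsto 0).mono_left nhdsWithin_le_nhds
    refine le_of_tendsto h1 ?_
    rw [eventually_nhdsWithin_iff]
    filter_upwards [closedBall_mem_nhds (0 : ℂ) (Real.exp_pos R₁)] with u hu hu0
    exact key u hu0 (mem_closedBall_zero_iff.1 hu)
  · exact key z h0 hz

theorem frequently_cobounded_norm_le {θ₀ : ℝ → ℝ} (hpos : ∀ r > 0, 0 < θ₀ r)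
    (hθ : ∀ᶠ r : ℝ in atTop, θ₀ r ≤ theta f r₀ r) :
    ∃ᶠ u in Bornology.cobounded ℂ, ‖f u‖ ≤ r₀ := by
  intro hev
  rw [← comap_norm_atTop, eventually_comap] at hev
  obtain ⟨r, ⟨hr1, hr2⟩, hr3⟩ := ((hev.and hθ).and (eventually_gt_atTop 0)).exists
  have hempty : {t : ℝ | t ∈ Icc 0 (2 * Real.pi) ∧
      ‖f ((r : ℝ) * Complex.exp (t * Complex.I))‖ < r₀} = ∅ := by
    refine eq_empty_of_forall_notMem fun t ht => ?_
    refine hr1 (r * Complex.exp (t * Complex.I)) ?_ ht.2.le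
    simp [Complex.norm_exp_ofReal_mul_I, abs_of_pos hr3]
  have : theta f r₀ r = 0 := by rw [theta, hempty, measureReal_empty]
  linarith [hpos r hr3]

theorem isExteriorCovering (hf : Differentiable ℂ f) (hr₀ : 0 < r₀)
    (hS : singularValues f ⊆ closedBall (0 : ℂ) r₀) {R₁ : ℝ} (hR₁ : Real.log r₀ < R₁)
    (hW : logTracts f r₀ ⊆ {z : ℂ | R₁ < z.re})
    (hfreq : ∃ᶠ u in Bornology.cobounded ℂ, ‖f u‖ ≤ r₀) : IsExteriorCovering f r₀ where
  differentiable := hf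
  pos := hr₀
  deriv_ne_zero a ha h0 := by
    have h1 : f a ∈ singularValues f := subset_closure (Or.inl ⟨a, h0, rfl⟩)
    exact (mem_closedBall_zero_iff.1 (hS h1)).not_gt ha
  norm_le_of_asymptotic b hb := mem_closedBall_zero_iff.1 (hS (subset_closure (Or.inr hb)))
  lt_norm u hu := by
    by_contra! hle
    refine (norm_le_of_logTracts_subset hf.continuous hW (hle.trans ?_)).not_gt hu
    rw [← Real.log_le_iff_le_exp hr₀]
    exact hR₁.le
  frequently_le := hfreq

/-- The area captured at time `n + 2` is at least `δ_n` times the area of the set in question, with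
`∑ δ_n = ∞`, while the total captured area is finite. -/
theorem volume_norm_iterate_ge_eq_zero (hc : IsExteriorCovering f r₀) (hord : order f < ⊤)
    {R₁ : ℝ} (hR₁ : Real.log r₀ < R₁) {θ₀ : ℝ → ℝ} (hanti : AntitoneOn θ₀ (Ioi 0))
    (hsum : Tendsto (fun n : ℕ => ∑ k ∈ Finset.Icc 1 n, θ₀ (Real.exp^[k] 0)) atTop atTop)
    {κ c : ℝ} (hκ : κ ∈ Ioo (0 : ℝ) 1) (hc0 : 0 < c)
    (hG : ∀ ζ : ℂ, R₁ ≤ ζ.re → ∃ ρ > 0, ρ ≤ κ * (ζ.re - Real.log r₀) ∧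
      ENNReal.ofReal (c * θ₀ (Real.exp ζ.re) * ρ ^ 2) ≤ volume (ball ζ ρ \ logTracts f r₀))
    (R : ℝ) :
    volume {z : ℂ | ‖z‖ ≤ R ∧ ∀ n, Real.exp R₁ ≤ ‖f^[n] z‖} = 0 := by
  set A := {z : ℂ | ‖z‖ ≤ R ∧ ∀ n, Real.exp R₁ ≤ ‖f^[n] z‖} with hA
  have hpos := pos_of_tendsto_sum hanti hsum
  obtain ⟨C, hC, c', hc', hloc⟩ := exists_ball_captureSet hc hR₁ hκ hc0 hG
  obtain ⟨m, hm⟩ := exists_norm_iterate_le hc.differentiable.continuous hord R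
  set D : Set ℂ := ball 0 (R + C * R) with hD
  have hstep : ∀ n, ENNReal.ofReal (c' * θ₀ (Real.exp^[n + 1 + m] 0)) * volume A ≤
      ENNReal.ofReal (16 * Real.pi) * volume (captureSet f r₀ n ∩ D) := by
    intro n
    refine ofReal_mul_volume_le_of_forall_exists_ball
      (measurableSet_captureSet hc.differentiable.continuous r₀ n) (ρ := C * R) ?_
    rintro z ⟨hzR, hz⟩
    obtain ⟨r, hr0, hrC, hr⟩ := hloc n z (hz (n + 1))
    have hCR : C * ‖z‖ ≤ C * R := by gcongr
    refine ⟨r, hr0, hrC.trans hCR, ?_, le_trans (ENNReal.ofReal_le_ofReal ?_) hr⟩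
    · refine ball_subset_ball' ?_
      rw [dist_zero_right]; linarith
    · have h1 := hm (n + 1) z hzR
      have h2 : 0 < ‖f^[n + 1] z‖ := (Real.exp_pos _).trans_le (hz (n + 1))
      have h3 := hanti h2 (h2.trans_le h1) h1
      gcongr
  have hdisj : ∀ N : ℕ, ∑ n ∈ Finset.range N, volume (captureSet f r₀ n ∩ D) ≤ volume D := by
    intro N
    rw [← measure_biUnion_finset]
    · exact measure_mono (iUnion₂_subset fun n _ => inter_subset_right)
    · intro i _ j _ hij
      exact (pairwise_disjoint_captureSet f r₀ hij).mono inter_subset_left inter_subset_left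
    · exact fun n _ => (measurableSet_captureSet hc.differentiable.continuous r₀ n).inter
        measurableSet_ball
  by_contra hA0
  have hAfin : volume A ≠ ⊤ := by
    refine ((measure_mono ?_).trans_lt (measure_closedBall_lt_top (x := (0 : ℂ)) (r := R))).ne
    intro z hz
    exact mem_closedBall_zero_iff.2 hz.1
  have hDfin : volume D ≠ ⊤ := measure_ball_lt_top.ne
  set a := (volume A).toReal with ha
  have ha0 : 0 < a := ENNReal.toReal_pos hA0 hAfin
  have hbound : ∀ N : ℕ, c' * a * ∑ n ∈ Finset.range N, θ₀ (Real.exp^[n + 1 + m] 0) ≤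
      16 * Real.pi * (volume D).toReal := by
    intro N
    have h1 : ∑ n ∈ Finset.range N,
        ENNReal.ofReal (c' * θ₀ (Real.exp^[n + 1 + m] 0)) * volume A ≤
        ENNReal.ofReal (16 * Real.pi) * volume D := by
      refine (Finset.sum_le_sum fun n _ => hstep n).trans ?_
      rw [← Finset.mul_sum]
      gcongr
      exact hdisj N
    have hθ0 : ∀ n : ℕ, 0 < θ₀ (Real.exp^[n + 1 + m] 0) := by
      intro n
      refine hpos _ ?_
      rw [show n + 1 + m = (n + m) + 1 by ring, Function.iterate_succ_apply']
      exact Real.exp_pos _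
    have h2 := ENNReal.toReal_mono (ENNReal.mul_ne_top ENNReal.ofReal_ne_top hDfin) h1
    rw [ENNReal.toReal_sum fun n _ => ENNReal.mul_ne_top ENNReal.ofReal_ne_top hAfin,
      ENNReal.toReal_mul, ENNReal.toReal_ofReal (by positivity)] at h2
    refine le_trans (le_of_eq ?_) h2
    rw [Finset.mul_sum]
    refine Finset.sum_congr rfl fun n _ => ?_
    rw [ENNReal.toReal_mul, ENNReal.toReal_ofReal (mul_pos hc' (hθ0 n)).le, ← ha]
    ring
  have htend := (tendsto_sum_iterate_exp_add hsum m).const_mul_atTop (mul_pos hc' ha0)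
  obtain ⟨N, hN⟩ := (htend.eventually_gt_atTop (16 * Real.pi * (volume D).toReal)).exists
  exact (hbound N).not_gt hN

end EntireDynamics

theorem theorem3p1
    (f : ℂ → ℂ) (hf : EntireDynamics.ClassB f) (hord : EntireDynamics.order f < ⊤)
    (r₀ : ℝ) (hr₀ : 0 < r₀)
    (hS : EntireDynamics.singularValues f ⊆ Metric.closedBall (0 : ℂ) r₀)
    (R₁ : ℝ) (hR₁ : max (2 * Real.log r₀) (Real.log r₀ + 64 * Real.pi) < R₁)
    (hW : EntireDynamics.logTracts f r₀ ⊆ {z : ℂ | R₁ < z.re})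
    (θ₀ : ℝ → ℝ) (hanti : AntitoneOn θ₀ (Set.Ioi 0))
    (hθ : ∀ᶠ r : ℝ in Filter.atTop, θ₀ r ≤ EntireDynamics.theta f r₀ r)
    (hsum : Filter.Tendsto (fun n : ℕ => ∑ k ∈ Finset.Icc 1 n, θ₀ (Real.exp^[k] 0))
      Filter.atTop Filter.atTop) :
    MeasureTheory.volume (EntireDynamics.juliaSet f) = 0 := by
  have hfd : Differentiable ℂ f := hf.1.1
  have hR : Real.log r₀ < R₁ := by
    have := (le_max_right (2 * Real.log r₀) (Real.log r₀ + 64 * Real.pi)).trans_lt hR₁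
    linarith [Real.pi_pos]
  have hpos := EntireDynamics.pos_of_tendsto_sum hanti hsum
  have hc := EntireDynamics.isExteriorCovering hfd hr₀ hS hR hW
    (EntireDynamics.frequently_cobounded_norm_le hpos hθ)
  obtain ⟨κ, hκ, c, hc0, hG⟩ :=
    EntireDynamics.exists_ball_diff_logTracts hfd.continuous hR hW hanti hpos hθ
  refine measure_mono_null (fun z hz => ?_) (measure_iUnion_null fun j : ℕ =>
    EntireDynamics.volume_norm_iterate_ge_eq_zero hc hord hR hanti hsum hκ hc0 hG j)
  obtain ⟨j, hj⟩ := exists_nat_ge ‖z‖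
  refine mem_iUnion.2 ⟨j, hj, fun n => ?_⟩
  exact EntireDynamics.norm_iterate_ge_of_mem_juliaSet hfd hr₀.le
    ((Real.log_lt_iff_lt_exp hr₀).1 hR)
    (fun w hw => EntireDynamics.norm_le_of_logTracts_subset hfd.continuous hW hw) hz n
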